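/- Setting. For every integer $m\ge 2$ let $p_{1,m},\dots,p_{m,m}$ be random variables with values in $[0,1]$ ($p$-values) on a probability space $(\Omega_m,\mathcal A_m,P_m)$, and let $\{1,\dots,m\}=I_{0,m}\sqcup I_{1,m}$ be a deterministic partition into true and false null hypotheses with $m_0:=\#I_{0,m}\ge 1$. Assume that the $(p_{i,m})_{i\in I_{0,m}}$ are independent and uniformly distributed on $[0,1]$ and that the vectors $(p_{i,m})_{i\in I_{0,m}}$ and $(p_{i,m})_{i\in I_{1,m}}$ are independent (with arbitrary dependence within the second one). Let $\widehat F_m$ be the empirical distribution function of $p_{1,m},\dots,p_{m,m}$ and $R_m(t):=m\widehat F_m(t)=\#\{i\le m: p_{i,m}\le t\}$. Given (possibly data dependent) critical values $0=c_0<c_1\le\dots\le c_m<1$, the step-up test has $R_m:=\max\{i\in\{0,\dots,m\}: p_{i:m}\le c_i\}$ rejections, where $p_{1:m}\le\dots\le p_{m:m}$ are the ordered $p$-values and $p_{0:m}:=0$; it rejects the $i$-th null hypothesis iff $p_{i,m}\le c_{R_m}$. Let $V_m:=\#\{i\in I_{0,m}: p_{i,m}\le c_{R_m}\}$ be the number of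 false rejections. The (sequence of) tests is called consistent if $V_m/R_m-E_{P_m}(V_m/R_m)\to 0$ in $P_m$-probability as $m\to\infty$, where $0/0:=0$. Fix $0<\alpha\le\lambda<1$. The BH test is the step-up test with critical values $\frac{i}{m}\alpha$, $i=0,\dots,m$. Let $\widehat m_0=\widehat m_0\big((\widehat F_m(t))_{t\ge\lambda}\big)>0$ be estimators that are measurable functions of $(\widehat F_m(t))_{t\ge\lambda}$ only. The adaptive test is the step-up test with critical values $\min\{\frac{i}{\widehat m_0}\alpha,\lambda\}$, $i=0,\dots,m$. Lemma. Suppose that (A1) $m_0/m\to\kappa_0$ for some $\kappa_0\in(0,1]$; (A3) there is some $K>0$ such that $\widehat m_0\le Km$ for all $m$; (A4) there is a constant $C>1$ with $\lim_{m\to\infty}P_m\big(\widehat m_0\ge \frac{C\alpha}{\lambda}\max\{R_m(\lambda),1\}\big)=1$; and that $\widehat m_0/m\to C_0$ in $P_m$-probability for some constant $C_0\in[\alpha\kappa_0,1]$. If $C_0=1$, suppose additionally that $P_m(\widehat m_0/m\le 1)\to 1$. Then consistency of the BH test implies consistency of the adaptive test. -/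

import Mathlib

open MeasureTheory ProbabilityTheory Filter Topology

noncomputable section

namespace AdaptiveTest

/-- The basic independence model for the `p`-values `p i`, `i : Fin m`, on the probability space
`(Ω, P)`: the hypotheses in `I₀` are the true nulls, those in the complement are the false nulls.
The true null `p`-values are i.i.d. uniform on `[0, 1]` and, as a vector, independent of the vector
of the false null `p`-values, whose joint law is arbitrary. There is at least one true null. -/
structure BasicIndependence {Ω : Type*} [MeasurableSpace Ω] (P : Measure Ω) {m : ℕ}
    (I₀ : Finset (Fin m)) (p : Fin m → Ω → ℝ) : Prop where
  measurable : ∀ i, Measurable (p i)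
  mem_Icc : ∀ i ω, p i ω ∈ Set.Icc (0 : ℝ) 1
  nonempty : I₀.Nonempty
  indep_true_false : IndepFun (fun ω (i : {i // i ∈ I₀}) => p i.1 ω)
    (fun ω (i : {i // i ∉ I₀}) => p i.1 ω) P
  indep_true : iIndepFun (fun i : {i // i ∈ I₀} => p i.1) P
  uniform : ∀ i ∈ I₀, ∀ x ∈ Set.Icc (0 : ℝ) 1, P {ω | p i ω ≤ x} = ENNReal.ofReal x

/-- `R_m(t)`: the number of `p`-values that are at most `t`. -/
def countLE {m : ℕ} (x : Fin m → ℝ) (t : ℝ) : ℕ :=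
  (Finset.univ.filter fun i => x i ≤ t).card

/-- The empirical distribution function of the `p`-values. -/
def ecdf {m : ℕ} (x : Fin m → ℝ) (t : ℝ) : ℝ :=
  (countLE x t : ℝ) / m

/-- The order statistics `x_{1:m} ≤ … ≤ x_{m:m}`, with `x_{0:m} = 0`
(and the irrelevant value `0` for an index beyond `m`). -/
def orderStat {m : ℕ} (x : Fin m → ℝ) (i : ℕ) : ℝ :=
  if h : 1 ≤ i ∧ i ≤ m then x (Tuple.sort x ⟨i - 1, by omega⟩) else 0

open Classical in
/-- The number of rejections of the step-up test with critical values `c`: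
the largest `i ∈ {0, …, m}` with `x_{i:m} ≤ c i`. -/
def stepUpR {m : ℕ} (c : ℕ → ℝ) (x : Fin m → ℝ) : ℕ :=
  Nat.findGreatest (fun i => orderStat x i ≤ c i) m

/-- The number of false rejections of the step-up test with critical values `c`, which rejects the
`i`-th hypothesis iff `x i ≤ c R` with `R` the number of rejections. -/
def stepUpV {m : ℕ} (c : ℕ → ℝ) (I₀ : Finset (Fin m)) (x : Fin m → ℝ) : ℕ :=
  (I₀.filter fun i => x i ≤ c (stepUpR c x)).card

/-- The false discovery proportion `V / R` (with `0 / 0 = 0`). -/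
def FDP {m : ℕ} (c : ℕ → ℝ) (I₀ : Finset (Fin m)) (x : Fin m → ℝ) : ℝ :=
  (stepUpV c I₀ x : ℝ) / (stepUpR c x : ℝ)

/-- The critical values of the Benjamini-Hochberg test. -/
def critBH (α : ℝ) (m : ℕ) (i : ℕ) : ℝ := (i : ℝ) / m * α

/-- The critical values of the adaptive test for the value `e` of the estimator of the number
of true nulls. -/
def critAdaptive (α lam : ℝ) (e : ℝ) (i : ℕ) : ℝ := min ((i : ℝ) / e * α) lam

/-- The estimator of the number of true nulls that is the function `g` of the empirical
distribution function restricted to `[lam, ∞)`. -/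
def estimate {lam : ℝ} {m : ℕ} (g : (Set.Ici lam → ℝ) → ℝ) (x : Fin m → ℝ) : ℝ :=
  g fun t => ecdf x t

/-- Convergence of `X m` to the constant `c` in `P m`-probability, as `m → ∞`. -/
def TendstoInProb {Ω : ℕ → Type*} [∀ m, MeasurableSpace (Ω m)] (P : ∀ m, Measure (Ω m))
    (X : ∀ m, Ω m → ℝ) (c : ℝ) : Prop :=
  ∀ ε : ℝ, 0 < ε → Tendsto (fun m => P m {ω | ε ≤ |X m ω - c|}) atTop (𝓝 0)

/-- Consistency of a sequence of tests with false discovery proportions `X m`: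
`X m - E (X m) → 0` in `P m`-probability. -/
def Consistent {Ω : ℕ → Type*} [∀ m, MeasurableSpace (Ω m)] (P : ∀ m, Measure (Ω m))
    (X : ∀ m, Ω m → ℝ) : Prop :=
  TendstoInProb P (fun m ω => X m ω - ∫ ω', X m ω' ∂(P m)) 0

end AdaptiveTest

end

open AdaptiveTest

/-! Write the false discovery proportion of the adaptive test as a sum over true nulls of shares
`D_j` = (indicator that `j` is rejected)/R, and compare `D_j` with `L_j` = (indicator that p_j ≤ λ)
· α/(λ m̂₀), everything cut down to a good event on which the cap λ on the critical values is
inactive and m̂₀/m lies in [C₀/2, 1]. Lowering a rejected p-value to 0 changes neither R nor m̂₀, so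
averaging over the independent uniform p_j turns both `D_j` and `L_j` into α/m̂₀
(`Admissible.average_rejShare_mul`). Applied to products, this makes all mixed moments agree, and
only the diagonal survives: E(∑(D_j - L_j))² = ∑(E D_j² - E L_j²)
(`Admissible.integral_sq_sum_sub`).

The BH test is the special case λ = 1, m̂₀ = m, where `L_j` = α/m is deterministic; there the
identity says that ∑ E D_j² is the variance of the BH proportion plus m₀(α/m)². On the good event
the adaptive test rejects at least as much as BH, so its diagonal is at most a constant times that
of BH (`integral_rejShare_sq_le`). Consistency of BH makes the variance vanish, since the
proportions are bounded. Hence the adaptive proportion is asymptotically ∑ L_j = V(λ) α/(λ m̂₀),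
V(λ) being the number of true null p-values ≤ λ. By the law of large numbers this tends to κ₀α/C₀. A
bounded sequence with a constant limit in probability is consistent. -/

namespace AdaptiveTest

/-! ### Deterministic properties of step-up tests, and measurability. -/

section StepUp

variable {m : ℕ}

lemma countLE_mono (x : Fin m → ℝ) : Monotone (countLE x) := fun _ _ h =>
  Finset.card_le_card (Finset.monotone_filter_right _ fun _ _ hi => le_trans hi h)

lemma countLE_le (x : Fin m → ℝ) (t : ℝ) : countLE x t ≤ m :=
  (Finset.card_filter_le _ _).trans (by simp)

/-- Trades order statistics for counts, so that sorting plays no further role: R becomes the largest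
k ≤ m with k ≤ `countLE x (c k)`. -/
lemma orderStat_le_iff (x : Fin m → ℝ) {i : ℕ} (hi : 1 ≤ i) (him : i ≤ m) (t : ℝ) :
    orderStat x i ≤ t ↔ i ≤ countLE x t := by
  have h := Tuple.lt_card_le_iff_apply_le_of_monotone (j := (⟨i - 1, by omega⟩ : Fin m)) (a := t)
    (Tuple.monotone_sort x)
  have hcard : (Finset.univ.filter fun k => (x ∘ Tuple.sort x) k ≤ t).card = countLE x t :=
    Finset.card_equiv (Tuple.sort x) (by simp)
  rw [hcard] at h
  rw [orderStat, dif_pos ⟨hi, him⟩]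
  simp only [Function.comp_apply] at h
  rw [← h]
  omega

lemma stepUpR_le (c : ℕ → ℝ) (x : Fin m → ℝ) : stepUpR c x ≤ m := Nat.findGreatest_le m

lemma le_stepUpR {c : ℕ → ℝ} {x : Fin m → ℝ} {k : ℕ} (hk : k ≤ m) (h : k ≤ countLE x (c k)) :
    k ≤ stepUpR c x := by
  classical
  rcases Nat.eq_zero_or_pos k with rfl | hk0
  · exact Nat.zero_le _
  · exact Nat.le_findGreatest hk ((orderStat_le_iff x hk0 hk _).2 h)

lemma stepUpR_le_countLE (c : ℕ → ℝ) (x : Fin m → ℝ) :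
    stepUpR c x ≤ countLE x (c (stepUpR c x)) := by
  classical
  rcases Nat.eq_zero_or_pos (stepUpR c x) with h0 | h0
  · omega
  · exact (orderStat_le_iff x h0 (stepUpR_le c x) _).1
      (Nat.findGreatest_of_ne_zero (P := fun i => orderStat x i ≤ c i) (n := m) rfl h0.ne')

/-- If the count at the threshold exceeded R, then by monotonicity of `c` the count itself would be
an index satisfying the step-up condition, against maximality of R. -/
lemma countLE_le_stepUpR {c : ℕ → ℝ} (hc : Monotone c) (x : Fin m → ℝ) :
    countLE x (c (stepUpR c x)) ≤ stepUpR c x := by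
  by_contra! h
  have h2 := le_stepUpR (c := c) (x := x) (countLE_le x _) (countLE_mono x (hc h.le))
  omega

lemma stepUpR_mono_crit {c d : ℕ → ℝ} {x : Fin m → ℝ} (h : ∀ i ≤ m, c i ≤ d i) :
    stepUpR c x ≤ stepUpR d x :=
  le_stepUpR (stepUpR_le c x)
    ((stepUpR_le_countLE c x).trans (countLE_mono x (h _ (stepUpR_le c x))))

lemma FDP_congr {c d : ℕ → ℝ} (h : ∀ i ≤ m, c i = d i) (I : Finset (Fin m)) (x : Fin m → ℝ) :
    FDP c I x = FDP d I x := by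
  have hR : stepUpR c x = stepUpR d x :=
    le_antisymm (stepUpR_mono_crit fun i hi => (h i hi).le)
      (stepUpR_mono_crit fun i hi => (h i hi).ge)
  rw [FDP, FDP, stepUpV, stepUpV, hR, h _ (stepUpR_le d x)]

lemma stepUpV_le_stepUpR {c : ℕ → ℝ} (hc : Monotone c) (I : Finset (Fin m)) (x : Fin m → ℝ) :
    stepUpV c I x ≤ stepUpR c x :=
  (Finset.card_le_card (Finset.filter_subset_filter _ (Finset.subset_univ _))).trans
    (countLE_le_stepUpR hc x)

lemma FDP_nonneg (c : ℕ → ℝ) (I : Finset (Fin m)) (x : Fin m → ℝ) : 0 ≤ FDP c I x := by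
  unfold FDP; positivity

lemma FDP_le_one {c : ℕ → ℝ} (hc : Monotone c) (I : Finset (Fin m)) (x : Fin m → ℝ) :
    FDP c I x ≤ 1 :=
  div_le_one_of_le₀ (by exact_mod_cast stepUpV_le_stepUpR hc I x) (by positivity)

/-- Lowering a coordinate to `0` can only increase the counts. -/
lemma countLE_update_zero_ge (x : Fin m → ℝ) (j : Fin m) {t : ℝ} (ht : 0 ≤ t) :
    countLE x t ≤ countLE (Function.update x j 0) t := by
  refine Finset.card_le_card fun i => ?_
  simp only [Finset.mem_filter, Finset.mem_univ, true_and]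
  intro hi
  rcases eq_or_ne i j with rfl | hij
  · simpa using ht
  · simpa [hij] using hi

lemma countLE_update_zero_eq (x : Fin m → ℝ) (j : Fin m) {t : ℝ} (ht : 0 ≤ t) (hj : x j ≤ t) :
    countLE (Function.update x j 0) t = countLE x t := by
  refine congrArg Finset.card (Finset.filter_congr fun i _ => ?_)
  rcases eq_or_ne i j with rfl | hij
  · simp [ht, hj]
  · simp [hij]

lemma one_le_countLE_update_zero (x : Fin m → ℝ) (j : Fin m) {t : ℝ} (ht : 0 ≤ t) :
    1 ≤ countLE (Function.update x j 0) t :=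
  Finset.card_pos.2 ⟨j, by simp [ht]⟩

lemma one_le_stepUpR_update_zero {c : ℕ → ℝ} (h0 : ∀ i, 0 ≤ c i) (x : Fin m → ℝ) (j : Fin m) :
    1 ≤ stepUpR c (Function.update x j 0) :=
  le_stepUpR (by have := j.isLt; omega) (one_le_countLE_update_zero x j (h0 1))

lemma stepUpR_update_zero_ge {c : ℕ → ℝ} (h0 : ∀ i, 0 ≤ c i) (x : Fin m → ℝ) (j : Fin m) :
    stepUpR c x ≤ stepUpR c (Function.update x j 0) :=
  le_stepUpR (stepUpR_le c x)
    ((stepUpR_le_countLE c x).trans (countLE_update_zero_ge x j (h0 _)))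

/-- A `p`-value that would be rejected after being lowered to `0` does not change the number of
rejections. -/
lemma stepUpR_update_zero_eq {c : ℕ → ℝ} (h0 : ∀ i, 0 ≤ c i) (x : Fin m → ℝ) (j : Fin m)
    (hj : x j ≤ c (stepUpR c (Function.update x j 0))) :
    stepUpR c (Function.update x j 0) = stepUpR c x := by
  refine le_antisymm (le_stepUpR (stepUpR_le _ _) ?_) (stepUpR_update_zero_ge h0 x j)
  rw [← countLE_update_zero_eq x j (h0 _) hj]
  exact stepUpR_le_countLE c _

/-- The leave-one-out principle for step-up tests. -/
lemma rejects_iff_update_zero {c : ℕ → ℝ} (hc : Monotone c) (h0 : ∀ i, 0 ≤ c i) (x : Fin m → ℝ)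
    (j : Fin m) :
    x j ≤ c (stepUpR c x) ↔ x j ≤ c (stepUpR c (Function.update x j 0)) :=
  ⟨fun h => h.trans (hc (stepUpR_update_zero_ge h0 x j)),
    fun h => by rwa [← stepUpR_update_zero_eq h0 x j h]⟩

lemma critAdaptive_mono {α lam e : ℝ} (hα : 0 ≤ α) (he : 0 ≤ e) :
    Monotone (critAdaptive α lam e) := fun i j hij => by
  unfold critAdaptive
  have : (i : ℝ) ≤ j := by exact_mod_cast hij
  gcongr

lemma critAdaptive_nonneg {α lam e : ℝ} (hα : 0 ≤ α) (hl : 0 ≤ lam) (he : 0 ≤ e) (i : ℕ) :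
    0 ≤ critAdaptive α lam e i := by
  unfold critAdaptive; positivity

lemma critBH_mono {α : ℝ} (hα : 0 ≤ α) (m : ℕ) : Monotone (critBH α m) := fun i j hij => by
  unfold critBH
  have : (i : ℝ) ≤ j := by exact_mod_cast hij
  gcongr

/-- A cap at 1 never acts on indices up to m, so every result on adaptive tests also covers BH. -/
lemma critBH_eq_critAdaptive {α : ℝ} (hα : 0 ≤ α) (hα1 : α ≤ 1) {i : ℕ} (hi : i ≤ m) :
    critBH α m i = critAdaptive α 1 m i := by
  have h : (i : ℝ) / m ≤ 1 := div_le_one_of_le₀ (by exact_mod_cast hi) (by positivity)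
  rw [critBH, critAdaptive, min_eq_left]
  nlinarith

lemma critAdaptive_anti {α lam e f : ℝ} (hα : 0 ≤ α) (he : 0 < e) (hef : e ≤ f) (i : ℕ) :
    critAdaptive α lam f i ≤ critAdaptive α lam e i := by
  unfold critAdaptive; gcongr

lemma measurable_countLE : Measurable fun z : (Fin m → ℝ) × ℝ => countLE z.1 z.2 := by
  simp only [countLE, Finset.card_filter]
  refine Finset.measurable_sum _ fun i _ => Measurable.ite ?_ measurable_const measurable_const
  exact measurableSet_le (by fun_prop) (by fun_prop)

lemma measurable_stepUpR {β : Type*} [MeasurableSpace β] {c : β → ℕ → ℝ} {X : β → Fin m → ℝ}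
    (hc : ∀ i, Measurable fun b => c b i) (hX : Measurable X) :
    Measurable fun b => stepUpR (c b) (X b) := by
  classical
  refine measurable_findGreatest fun k hk => ?_
  rcases Nat.eq_zero_or_pos k with rfl | hk0
  · simp only [orderStat]
    exact measurableSet_le (by simp) (hc 0)
  · simp only [orderStat_le_iff _ hk0 hk]
    exact measurableSet_le measurable_const (measurable_countLE.comp (hX.prodMk (hc k)))

lemma measurable_FDP {β : Type*} [MeasurableSpace β] {c : β → ℕ → ℝ} {X : β → Fin m → ℝ}
    (hc : ∀ i, Measurable fun b => c b i) (hX : Measurable X) (I : Finset (Fin m)) :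
    Measurable fun b => FDP (c b) I (X b) := by
  have hR := measurable_stepUpR hc hX
  -- The critical value is taken at a random index; countability of ℕ gives joint measurability.
  have hcR : Measurable fun b => c b (stepUpR (c b) (X b)) :=
    (measurable_from_prod_countable_left (f := fun z : β × ℕ => c z.1 z.2) hc).comp
      (measurable_id.prodMk hR)
  have hV : Measurable fun b => stepUpV (c b) I (X b) := by
    simp only [stepUpV, Finset.card_filter]
    refine Finset.measurable_sum _ fun i _ => Measurable.ite ?_ measurable_const measurable_const
    exact measurableSet_le ((measurable_pi_apply i).comp hX) hcR
  exact (measurable_from_nat.comp hV).div (measurable_from_nat.comp hR)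

end StepUp

/-! ### Integrating out a single true null p-value. -/

section Replacement

/-- If `X` is independent of `Y` and `(X, Y)` is independent of `Z`, then `X` is independent of
`(Y, Z)`. -/
lemma indepFun_prodMk_of_indepFun {Ω β γ δ : Type*} [MeasurableSpace Ω] [MeasurableSpace β]
    [MeasurableSpace γ] [MeasurableSpace δ] {P : Measure Ω} [IsProbabilityMeasure P]
    {X : Ω → β} {Y : Ω → γ} {Z : Ω → δ} (hX : Measurable X) (hY : Measurable Y) (hZ : Measurable Z)
    (hXY : IndepFun X Y P) (hXYZ : IndepFun (fun ω => (X ω, Y ω)) Z P) :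
    IndepFun X (fun ω => (Y ω, Z ω)) P := by
  have : IsProbabilityMeasure (P.map X) := Measure.isProbabilityMeasure_map hX.aemeasurable
  have : IsProbabilityMeasure (P.map Y) := Measure.isProbabilityMeasure_map hY.aemeasurable
  have : IsProbabilityMeasure (P.map Z) := Measure.isProbabilityMeasure_map hZ.aemeasurable
  have hYZ : IndepFun Y Z P := hXYZ.comp measurable_snd measurable_id
  rw [indepFun_iff_map_prod_eq_prod_map_map hX.aemeasurable (hY.prodMk hZ).aemeasurable,
    (indepFun_iff_map_prod_eq_prod_map_map hY.aemeasurable hZ.aemeasurable).1 hYZ,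
    ← Measure.prodAssoc_prod,
    ← (indepFun_iff_map_prod_eq_prod_map_map hX.aemeasurable hY.aemeasurable).1 hXY,
    ← (indepFun_iff_map_prod_eq_prod_map_map (hX.prodMk hY).aemeasurable hZ.aemeasurable).1 hXYZ,
    Measure.map_map (MeasurableEquiv.measurable _) (by fun_prop)]
  rfl

lemma BasicIndependence.measurable_pi {Ω : Type*} [MeasurableSpace Ω] {P : Measure Ω} {m : ℕ}
    {I : Finset (Fin m)} {p : Fin m → Ω → ℝ} (h : BasicIndependence P I p) :
    Measurable fun ω i => p i ω := measurable_pi_iff.2 h.measurable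

variable {Ω : Type*} [MeasurableSpace Ω] {P : Measure Ω} [IsProbabilityMeasure P] {m : ℕ}
  {I : Finset (Fin m)} {p : Fin m → Ω → ℝ}

lemma BasicIndependence.map_eq (h : BasicIndependence P I p) {j : Fin m} (hj : j ∈ I) :
    P.map (p j) = volume.restrict (Set.Icc (0 : ℝ) 1) := by
  have : IsProbabilityMeasure (P.map (p j)) :=
    Measure.isProbabilityMeasure_map (h.measurable j).aemeasurable
  refine Measure.ext_of_Iic _ _ fun a => ?_
  rw [Measure.map_apply (h.measurable j) measurableSet_Iic, Measure.restrict_apply measurableSet_Iic]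
  rcases lt_or_ge a 0 with ha | ha
  · rw [show p j ⁻¹' Set.Iic a = ∅ by
      ext ω; simpa using ha.trans_le (h.mem_Icc j ω).1,
      show Set.Iic a ∩ Set.Icc (0 : ℝ) 1 = ∅ by
      ext u; simp only [Set.mem_inter_iff, Set.mem_Iic, Set.mem_Icc, Set.mem_empty_iff_false, iff_false]
      intro hu; linarith [hu.1, hu.2.1]]
    simp
  · rcases le_or_gt a 1 with ha1 | ha1
    · rw [show Set.Iic a ∩ Set.Icc (0 : ℝ) 1 = Set.Icc 0 a by
        ext u; simp only [Set.mem_inter_iff, Set.mem_Iic, Set.mem_Icc]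
        constructor
        · intro hu; exact ⟨hu.2.1, hu.1⟩
        · intro hu; exact ⟨hu.2, hu.1, hu.2.trans ha1⟩]
      rw [Real.volume_Icc, sub_zero]
      exact h.uniform j hj a ⟨ha, ha1⟩
    · rw [show p j ⁻¹' Set.Iic a = Set.univ by
        ext ω; simpa using (h.mem_Icc j ω).2.trans ha1.le,
        show Set.Iic a ∩ Set.Icc (0 : ℝ) 1 = Set.Icc 0 1 by
        ext u; simp only [Set.mem_inter_iff, Set.mem_Iic, Set.mem_Icc]
        constructor
        · intro hu; exact hu.2
        · intro hu; exact ⟨hu.2.trans ha1.le, hu⟩]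
      simp

/-- A true null `p`-value is independent of the vector of all other `p`-values. -/
lemma BasicIndependence.indepFun_update (h : BasicIndependence P I p) {j : Fin m} (hj : j ∈ I) :
    IndepFun (p j) (fun ω => Function.update (fun i => p i ω) j 0) P := by
  classical
  -- Independence from the other true nulls is joined with independence from the false nulls; `ψ`
  -- below reassembles the full vector with 0 in place `j`.
  let S : Finset {i // i ∈ I} := {⟨j, hj⟩}
  have hind := h.indep_true.indepFun_finset S Sᶜ disjoint_compl_right fun i => h.measurable i.1
  have hX : IndepFun (p j) (fun ω (i : (Sᶜ : Finset {i // i ∈ I})) => p i.1.1 ω) P :=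
    hind.comp (φ := fun f : S → ℝ => f ⟨⟨j, hj⟩, by simp [S]⟩) (ψ := id)
      (measurable_pi_apply _) measurable_id
  have hXY : IndepFun (fun ω => (p j ω, fun i : (Sᶜ : Finset {i // i ∈ I}) => p i.1.1 ω))
      (fun ω (i : {i // i ∉ I}) => p i.1 ω) P :=
    h.indep_true_false.comp
      (φ := fun f => (f ⟨j, hj⟩, fun i : (Sᶜ : Finset {i // i ∈ I}) => f i.1)) (ψ := id)
      ((measurable_pi_apply _).prodMk (measurable_pi_iff.2 fun i => measurable_pi_apply _))
      measurable_id
  have key := indepFun_prodMk_of_indepFun (h.measurable j)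
    (measurable_pi_iff.2 fun i => h.measurable _) (measurable_pi_iff.2 fun i => h.measurable _)
    hX hXY
  let ψ : ((Sᶜ : Finset {i // i ∈ I}) → ℝ) × ({i // i ∉ I} → ℝ) → Fin m → ℝ := fun f i =>
    if hi : i ∈ I then if hij : i = j then 0 else f.1 ⟨⟨i, hi⟩, by simpa [S] using hij⟩
    else f.2 ⟨i, hi⟩
  have hψ : Measurable ψ := by
    refine measurable_pi_iff.2 fun i => ?_
    by_cases hi : i ∈ I
    · by_cases hij : i = j
      · simp [ψ, hij, hj]
      · simp only [ψ, hi, hij, dif_pos, dif_neg, not_false_iff]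
        exact (measurable_pi_apply _).comp measurable_fst
    · simp only [ψ, hi, dif_neg, not_false_iff]
      exact (measurable_pi_apply _).comp measurable_snd
  convert (show IndepFun (p j) _ P from key.comp measurable_id hψ) using 1
  funext ω i
  by_cases hi : i ∈ I
  · by_cases hij : i = j
    · subst hij; simp [ψ, hj]
    · simp [ψ, hi, hij]
  · have hij : i ≠ j := fun hij => hi (hij ▸ hj)
    simp [ψ, hi, hij]

/-- A true null `p`-value may be replaced by an independent uniform variable. -/
lemma BasicIndependence.integral_eq (h : BasicIndependence P I p) {j : Fin m} (hj : j ∈ I)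
    {f : (Fin m → ℝ) → ℝ} (hf : Measurable f) {B : ℝ} (hB : ∀ x, |f x| ≤ B) :
    ∫ ω, f (fun i => p i ω) ∂P =
      ∫ ω, (∫ u in Set.Icc (0 : ℝ) 1, f (Function.update (fun i => p i ω) j u)) ∂P := by
  have hYm : Measurable fun ω => Function.update (fun i => p i ω) j (0 : ℝ) := by
    refine measurable_pi_iff.2 fun i => ?_
    rcases eq_or_ne i j with rfl | hij
    · simp
    · simpa [hij] using h.measurable i
  have hind := (indepFun_iff_map_prod_eq_prod_map_map hYm.aemeasurable
    (h.measurable j).aemeasurable).1 (h.indepFun_update hj).symm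
  have hFm : Measurable fun z : (Fin m → ℝ) × ℝ => f (Function.update z.1 j z.2) := by
    refine hf.comp (measurable_pi_iff.2 fun i => ?_)
    rcases eq_or_ne i j with rfl | hij
    · simpa using measurable_snd
    · simp only [Function.update_of_ne hij]
      fun_prop
  have : IsProbabilityMeasure (P.map (p j)) :=
    Measure.isProbabilityMeasure_map (h.measurable j).aemeasurable
  have : IsProbabilityMeasure (P.map fun ω => Function.update (fun i => p i ω) j (0 : ℝ)) :=
    Measure.isProbabilityMeasure_map hYm.aemeasurable
  calc ∫ ω, f (fun i => p i ω) ∂P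
      = ∫ ω, (fun z : (Fin m → ℝ) × ℝ => f (Function.update z.1 j z.2))
          (Function.update (fun i => p i ω) j 0, p j ω) ∂P := by
        refine integral_congr_ae (Eventually.of_forall fun ω => ?_)
        simp only [Function.update_idem]
        congr 1
        exact (Function.update_eq_self j (fun i => p i ω)).symm
    _ = ∫ z, f (Function.update z.1 j z.2) ∂((P.map fun ω => Function.update (fun i => p i ω) j
          (0 : ℝ)).prod (P.map (p j))) := by
        rw [← hind, integral_map (hYm.prodMk (h.measurable j)).aemeasurable
          hFm.aestronglyMeasurable]
    _ = ∫ y, ∫ u, f (Function.update y j u) ∂(P.map (p j)) ∂(P.map fun ω =>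
          Function.update (fun i => p i ω) j (0 : ℝ)) :=
        integral_prod _ (Integrable.of_bound hFm.aestronglyMeasurable B
          (Eventually.of_forall fun z => hB _))
    _ = _ := by
        rw [integral_map hYm.aemeasurable
          (hFm.stronglyMeasurable.integral_prod_right').aestronglyMeasurable, h.map_eq hj]
        simp only [Function.update_idem]

/-- Two bounded functions of the `p`-values whose averages over the `j`-th coordinate agree have
the same expectation. -/
lemma BasicIndependence.integral_congr_average (h : BasicIndependence P I p) {j : Fin m}
    (hj : j ∈ I) {f g : (Fin m → ℝ) → ℝ} (hf : Measurable f) (hg : Measurable g) {B : ℝ}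
    (hfB : ∀ x, |f x| ≤ B) (hgB : ∀ x, |g x| ≤ B)
    (hfg : ∀ x, (∀ i, 0 ≤ x i) → ∫ u in Set.Icc (0 : ℝ) 1, f (Function.update x j u) =
      ∫ u in Set.Icc (0 : ℝ) 1, g (Function.update x j u)) :
    ∫ ω, f (fun i => p i ω) ∂P = ∫ ω, g (fun i => p i ω) ∂P := by
  rw [h.integral_eq hj hf hfB, h.integral_eq hj hg hgB]
  exact integral_congr_ae (Eventually.of_forall fun ω => hfg _ fun i => (h.mem_Icc i ω).1)

end Replacement

/-! ### Rejection shares, their averages and mixed moments. -/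

section Shares

variable {m : ℕ}

/-- An estimator `e` and an event `A` that only depend on the `p`-values exceeding `lam` and on the
number of the others, where on `A` the estimator is so large that the truncation of the critical
values at `lam` is inactive. -/
structure Admissible (α lam : ℝ) (e : (Fin m → ℝ) → ℝ) (A : Set (Fin m → ℝ)) : Prop where
  measurable : Measurable e
  measurableSet : MeasurableSet A
  estimator_update : ∀ x j, x j ≤ lam → e (Function.update x j 0) = e x
  event_update : ∀ x j, x j ≤ lam → (Function.update x j 0 ∈ A ↔ x ∈ A)
  le_estimator : ∀ x ∈ A, α / lam * max (countLE x lam : ℝ) 1 ≤ e x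

/-- The number of rejections of the adaptive test with estimator `e`. -/
noncomputable def adaptiveR (α lam : ℝ) (e : (Fin m → ℝ) → ℝ) (x : Fin m → ℝ) : ℕ :=
  stepUpR (critAdaptive α lam (e x)) x

open Classical in
/-- The contribution of the `j`-th hypothesis to the false discovery proportion, on `A`. -/
noncomputable def rejShare (α lam : ℝ) (e : (Fin m → ℝ) → ℝ) (A : Set (Fin m → ℝ)) (j : Fin m)
    (x : Fin m → ℝ) : ℝ :=
  if x ∈ A ∧ x j ≤ critAdaptive α lam (e x) (adaptiveR α lam e x) then
    1 / (adaptiveR α lam e x : ℝ) else 0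

open Classical in
/-- The conditional expectation of `rejShare` given the `p`-values exceeding `lam`, spread over
the `p`-values at most `lam`. -/
noncomputable def lowShare (α lam : ℝ) (e : (Fin m → ℝ) → ℝ) (A : Set (Fin m → ℝ)) (j : Fin m)
    (x : Fin m → ℝ) : ℝ :=
  if x ∈ A ∧ x j ≤ lam then α / (lam * e x) else 0

variable {α lam : ℝ} {e : (Fin m → ℝ) → ℝ} {A : Set (Fin m → ℝ)}

lemma Admissible.pos (H : Admissible α lam e A) (hα : 0 < α) (hl : 0 < lam) {x : Fin m → ℝ}
    (hx : x ∈ A) : 0 < e x := by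
  refine lt_of_lt_of_le ?_ (H.le_estimator x hx)
  have : (0 : ℝ) < max (countLE x lam : ℝ) 1 := lt_max_of_lt_right one_pos
  positivity

lemma adaptiveR_le_countLE (x : Fin m → ℝ) : adaptiveR α lam e x ≤ countLE x lam :=
  (stepUpR_le_countLE _ _).trans (countLE_mono x (min_le_right _ _))

/-- The cap forces R ≤ `countLE x lam`, and on `A` the estimator dominates α/λ times that count.
Hence the cap is inactive at the index R. -/
lemma Admissible.mul_adaptiveR_le (H : Admissible α lam e A) (hα : 0 < α) (hl : 0 < lam)
    {x : Fin m → ℝ} (hx : x ∈ A) : (adaptiveR α lam e x : ℝ) / e x * α ≤ lam := by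
  have he := H.pos hα hl hx
  have h1 := H.le_estimator x hx
  have h2 : (adaptiveR α lam e x : ℝ) ≤ max (countLE x lam : ℝ) 1 :=
    le_max_of_le_left (by exact_mod_cast adaptiveR_le_countLE x)
  have h3 : α / lam * (adaptiveR α lam e x : ℝ) ≤ e x := le_trans (by gcongr) h1
  rw [div_mul_eq_mul_div, div_le_iff₀ he]
  rw [div_mul_eq_mul_div, div_le_iff₀ hl] at h3
  linarith

lemma Admissible.critAdaptive_eq (H : Admissible α lam e A) (hα : 0 < α) (hl : 0 < lam)
    {x : Fin m → ℝ} (hx : x ∈ A) :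
    critAdaptive α lam (e x) (adaptiveR α lam e x) = (adaptiveR α lam e x : ℝ) / e x * α :=
  min_eq_left (H.mul_adaptiveR_le hα hl hx)

lemma Admissible.one_le_adaptiveR (H : Admissible α lam e A) (hα : 0 < α) (hl : 0 < lam)
    {x : Fin m → ℝ} {j : Fin m} (hx : Function.update x j 0 ∈ A) :
    1 ≤ adaptiveR α lam e (Function.update x j 0) :=
  one_le_stepUpR_update_zero (critAdaptive_nonneg hα.le hl.le (H.pos hα hl hx).le) x j

/-- A rejected p-value is at most λ, so the estimator and with it the critical values stay fixed
when it is lowered; the leave-one-out principle for fixed critical values then applies. -/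
lemma Admissible.adaptiveR_update (H : Admissible α lam e A) (hα : 0 < α) (hl : 0 < lam)
    {x : Fin m → ℝ} {j : Fin m} (hx : x ∈ A)
    (hj : x j ≤ critAdaptive α lam (e x) (adaptiveR α lam e x)) :
    adaptiveR α lam e (Function.update x j 0) = adaptiveR α lam e x := by
  have he := (H.pos hα hl hx).le
  have hjl : x j ≤ lam := hj.trans (min_le_right _ _)
  have h := (rejects_iff_update_zero (critAdaptive_mono (lam := lam) hα.le he)
    (critAdaptive_nonneg hα.le hl.le he) x j).1 hj
  simp only [adaptiveR, H.estimator_update x j hjl]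
  exact stepUpR_update_zero_eq (critAdaptive_nonneg hα.le hl.le he) x j h

/-- The rejection region of the `j`-th hypothesis in terms of the remaining `p`-values. -/
lemma Admissible.rejects_iff (H : Admissible α lam e A) (hα : 0 < α) (hl : 0 < lam)
    (x : Fin m → ℝ) (j : Fin m) :
    (x ∈ A ∧ x j ≤ critAdaptive α lam (e x) (adaptiveR α lam e x)) ↔
      (Function.update x j 0 ∈ A ∧
        x j ≤ (adaptiveR α lam e (Function.update x j 0) : ℝ) / e (Function.update x j 0) * α) := by
  constructor
  · rintro ⟨hx, hj⟩
    have hjl : x j ≤ lam := hj.trans (min_le_right _ _)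
    rw [H.adaptiveR_update hα hl hx hj, H.estimator_update x j hjl, H.event_update x j hjl]
    exact ⟨hx, hj.trans (min_le_left _ _)⟩
  · rintro ⟨hx, hj⟩
    -- This bound must come from the lowered vector, since only after it is known can the estimator
    -- be carried back to `x`.
    have hjl : x j ≤ lam := hj.trans (H.mul_adaptiveR_le hα hl hx)
    rw [← H.critAdaptive_eq hα hl hx] at hj
    have he := (H.pos hα hl hx).le
    rw [adaptiveR, H.estimator_update x j hjl] at hj
    rw [H.estimator_update x j hjl] at he
    exact ⟨(H.event_update x j hjl).1 hx,
      (rejects_iff_update_zero (critAdaptive_mono (lam := lam) hα.le he)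
        (critAdaptive_nonneg hα.le hl.le he) x j).2 hj⟩

lemma rejShare_nonneg (j : Fin m) (x : Fin m → ℝ) : 0 ≤ rejShare α lam e A j x := by
  unfold rejShare; split_ifs <;> positivity

lemma rejShare_le_one (j : Fin m) (x : Fin m → ℝ) : rejShare α lam e A j x ≤ 1 := by
  unfold rejShare
  split_ifs
  · rw [one_div]; exact Nat.cast_inv_le_one _
  · exact zero_le_one

lemma Admissible.lowShare_nonneg (H : Admissible α lam e A) (hα : 0 < α) (hl : 0 < lam)
    (j : Fin m) (x : Fin m → ℝ) : 0 ≤ lowShare α lam e A j x := by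
  unfold lowShare
  split_ifs with h
  · have := H.pos hα hl h.1; positivity
  · exact le_rfl

lemma Admissible.lowShare_le_one (H : Admissible α lam e A) (hα : 0 < α) (hl : 0 < lam)
    (j : Fin m) (x : Fin m → ℝ) : lowShare α lam e A j x ≤ 1 := by
  unfold lowShare
  split_ifs with h
  · have he := H.pos hα hl h.1
    rw [div_le_one (by positivity)]
    have h1 : α / lam * 1 ≤ e x := le_trans (by gcongr; exact le_max_right _ _)
      (H.le_estimator x h.1)
    rw [mul_one, div_le_iff₀ hl] at h1
    linarith
  · exact zero_le_one

lemma Admissible.measurable_adaptiveR (H : Admissible α lam e A) :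
    Measurable (adaptiveR α lam e) := by
  refine measurable_stepUpR (fun i => ?_) measurable_id
  have := H.measurable
  unfold critAdaptive; fun_prop

lemma Admissible.measurable_rejShare (H : Admissible α lam e A) (j : Fin m) :
    Measurable (rejShare α lam e A j) := by
  have h1 := H.measurable
  have h2 : Measurable fun x => (adaptiveR α lam e x : ℝ) :=
    measurable_from_nat.comp H.measurable_adaptiveR
  refine Measurable.ite (H.measurableSet.inter (measurableSet_le (measurable_pi_apply j) ?_))
    (by fun_prop) measurable_const
  unfold critAdaptive; fun_prop

lemma Admissible.measurable_lowShare (H : Admissible α lam e A) (j : Fin m) :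
    Measurable (lowShare α lam e A j) := by
  have h1 := H.measurable
  exact Measurable.ite (H.measurableSet.inter
    (measurableSet_le (measurable_pi_apply j) measurable_const)) (by fun_prop) measurable_const

lemma Admissible.lowShare_update (H : Admissible α lam e A) (hl : 0 < lam) {x : Fin m → ℝ}
    {j : Fin m} (hj : x j ≤ lam) (k : Fin m) :
    lowShare α lam e A k (Function.update x j 0) = lowShare α lam e A k x := by
  unfold lowShare
  rw [H.estimator_update x j hj]
  classical
  refine if_congr (and_congr (H.event_update x j hj) ?_) rfl rfl
  rcases eq_or_ne k j with rfl | hkj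
  · simp [hj, hl.le]
  · simp [hkj]

/-- Unlike `lowShare`, this share depends on R, so invariance requires `x j` to be rejected and not
merely at most λ. -/
lemma Admissible.rejShare_update (H : Admissible α lam e A) (hα : 0 < α) (hl : 0 < lam)
    {x : Fin m → ℝ} {j : Fin m} (hx : x ∈ A)
    (hj : x j ≤ critAdaptive α lam (e x) (adaptiveR α lam e x)) (k : Fin m) :
    rejShare α lam e A k (Function.update x j 0) = rejShare α lam e A k x := by
  have hjl : x j ≤ lam := hj.trans (min_le_right _ _)
  unfold rejShare
  rw [H.estimator_update x j hjl, H.adaptiveR_update hα hl hx hj]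
  classical
  refine if_congr (and_congr (H.event_update x j hjl) ?_) rfl rfl
  rcases eq_or_ne k j with rfl | hkj
  · have := critAdaptive_nonneg hα.le hl.le (H.pos hα hl hx).le (adaptiveR α lam e x)
    simp [hj, this]
  · simp [hkj]

lemma setIntegral_Icc_ite_le {b : ℝ} (hb0 : 0 ≤ b) (hb1 : b ≤ 1) (k : ℝ) :
    ∫ u in Set.Icc (0 : ℝ) 1, (if u ≤ b then k else 0) = b * k := by
  have h : (fun u : ℝ => if u ≤ b then k else 0) = (Set.Iic b).indicator fun _ => k := by
    funext u; simp [Set.indicator]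
  rw [h, setIntegral_indicator measurableSet_Iic]
  have h2 : Set.Icc (0 : ℝ) 1 ∩ Set.Iic b = Set.Icc 0 b := by
    ext u; simp only [Set.mem_inter_iff, Set.mem_Iic, Set.mem_Icc]
    exact ⟨fun hu => ⟨hu.1.1, hu.2⟩, fun hu => ⟨⟨hu.1, hu.2.trans hb1⟩, hu.2⟩⟩
  rw [h2]
  simp [hb0]

/-- Averaged over the `j`-th `p`-value, `rejShare` and `lowShare` agree. -/
lemma Admissible.average_rejShare_mul (H : Admissible α lam e A) (hα : 0 < α) (hl : 0 < lam)
    (hl1 : lam ≤ 1) (j : Fin m) {ψ : (Fin m → ℝ) → ℝ}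
    (hψ : ∀ x ∈ A, x j ≤ critAdaptive α lam (e x) (adaptiveR α lam e x) →
      ψ (Function.update x j 0) = ψ x) (x : Fin m → ℝ) :
    ∫ u in Set.Icc (0 : ℝ) 1, rejShare α lam e A j (Function.update x j u) *
        ψ (Function.update x j u) =
      ∫ u in Set.Icc (0 : ℝ) 1, lowShare α lam e A j (Function.update x j u) *
        ψ (Function.update (Function.update x j u) j 0) := by
  set y := Function.update x j 0 with hy
  have hupd : ∀ u, Function.update (Function.update x j u) j 0 = y := fun u => by simp [hy]
  by_cases hyA : y ∈ A
  · have he := H.pos hα hl hyA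
    have hR : (1 : ℝ) ≤ adaptiveR α lam e y := by exact_mod_cast H.one_le_adaptiveR hα hl hyA
    have h1 : ∀ u, rejShare α lam e A j (Function.update x j u) * ψ (Function.update x j u) =
        if u ≤ (adaptiveR α lam e y : ℝ) / e y * α then 1 / (adaptiveR α lam e y : ℝ) * ψ y
        else 0 := by
      intro u
      have hiff := H.rejects_iff hα hl (Function.update x j u) j
      rw [hupd, Function.update_self] at hiff
      simp only [hyA, true_and] at hiff
      by_cases hu : u ≤ (adaptiveR α lam e y : ℝ) / e y * α
      · have hr := hiff.2 hu
        rw [if_pos hu, rejShare, Function.update_self, if_pos hr]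
        have hr' : Function.update x j u j ≤ critAdaptive α lam (e (Function.update x j u))
          (adaptiveR α lam e (Function.update x j u)) := by simpa using hr.2
        have e1 := H.adaptiveR_update hα hl hr.1 hr'
        have e2 := hψ _ hr.1 hr'
        rw [hupd] at e1 e2
        rw [e1, e2]
      · rw [if_neg hu, rejShare, Function.update_self, if_neg fun hr => hu (hiff.1 hr), zero_mul]
    have h2 : ∀ u, lowShare α lam e A j (Function.update x j u) *
        ψ (Function.update (Function.update x j u) j 0) =
        if u ≤ lam then α / (lam * e y) * ψ y else 0 := by
      intro u
      rw [hupd, lowShare, Function.update_self]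
      by_cases hu : u ≤ lam
      · have hu' : Function.update x j u j ≤ lam := by simpa using hu
        have e1 := H.event_update _ j hu'
        have e2 := H.estimator_update _ j hu'
        rw [hupd] at e1 e2
        rw [if_pos hu, if_pos ⟨e1.1 hyA, hu⟩, e2]
      · rw [if_neg hu, if_neg fun h => hu h.2, zero_mul]
    simp only [h1, h2]
    -- With R and e taken at `y`, the two averages are (Rα/e)·(1/R) and λ·α/(λe), both α/e, times `ψ
    -- y`.
    rw [setIntegral_Icc_ite_le (by positivity) ((H.mul_adaptiveR_le hα hl hyA).trans hl1),
      setIntegral_Icc_ite_le hl.le hl1]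
    field_simp
  · have h1 : ∀ u, rejShare α lam e A j (Function.update x j u) = 0 := by
      intro u
      refine if_neg fun hr => hyA ?_
      have := (H.rejects_iff hα hl _ j).1 hr
      rw [hupd] at this
      exact this.1
    have h2 : ∀ u, lowShare α lam e A j (Function.update x j u) = 0 := by
      intro u
      refine if_neg fun hr => hyA ?_
      have := (H.event_update _ j hr.2).2 hr.1
      rwa [hupd] at this
    simp [h1, h2]

section Expectation

variable {Ω : Type*} [MeasurableSpace Ω] {P : Measure Ω} [IsProbabilityMeasure P]
  {I : Finset (Fin m)} {p : Fin m → Ω → ℝ}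

lemma abs_mul_le_one {a b : ℝ} (ha : 0 ≤ a) (ha1 : a ≤ 1) (hb : 0 ≤ b) (hb1 : b ≤ 1) :
    |a * b| ≤ 1 := by
  rw [abs_of_nonneg (mul_nonneg ha hb)]; exact mul_le_one₀ ha1 hb hb1

lemma measurable_update_zero (j : Fin m) :
    Measurable fun x : Fin m → ℝ => Function.update x j 0 := by
  refine measurable_pi_iff.2 fun i => ?_
  rcases eq_or_ne i j with rfl | hij
  · simp
  · simp only [Function.update_of_ne hij]; fun_prop

/-- The second factor may itself depend on coordinate `j`; it is only required to ignore lowering a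
rejected `x j`, and hence appears on the right with that coordinate frozen at 0. -/
lemma Admissible.integral_rejShare_mul (H : Admissible α lam e A) (hα : 0 < α) (hl : 0 < lam)
    (hl1 : lam ≤ 1) (hp : BasicIndependence P I p) {j : Fin m} (hj : j ∈ I)
    {ψ : (Fin m → ℝ) → ℝ} (hψm : Measurable ψ) (hψ0 : ∀ x, 0 ≤ ψ x) (hψ1 : ∀ x, ψ x ≤ 1)
    (hψ : ∀ x ∈ A, x j ≤ critAdaptive α lam (e x) (adaptiveR α lam e x) →
      ψ (Function.update x j 0) = ψ x) :
    ∫ ω, rejShare α lam e A j (fun i => p i ω) * ψ (fun i => p i ω) ∂P =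
      ∫ ω, lowShare α lam e A j (fun i => p i ω) *
        ψ (Function.update (fun i => p i ω) j 0) ∂P := by
  refine hp.integral_congr_average hj
    (f := fun x => rejShare α lam e A j x * ψ x)
    (g := fun x => lowShare α lam e A j x * ψ (Function.update x j 0)) (B := 1)
    ((H.measurable_rejShare j).mul hψm)
    ((H.measurable_lowShare j).mul (hψm.comp (measurable_update_zero j))) ?_ ?_ ?_
  · exact fun x => abs_mul_le_one (rejShare_nonneg j x) (rejShare_le_one j x) (hψ0 _) (hψ1 _)
  · exact fun x => abs_mul_le_one (H.lowShare_nonneg hα hl j x) (H.lowShare_le_one hα hl j x)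
      (hψ0 _) (hψ1 _)
  · exact fun x _ => H.average_rejShare_mul hα hl hl1 j hψ x

lemma Admissible.integral_rejShare_mul_lowShare (H : Admissible α lam e A) (hα : 0 < α)
    (hl : 0 < lam) (hl1 : lam ≤ 1) (hp : BasicIndependence P I p) {j : Fin m} (hj : j ∈ I)
    (k : Fin m) :
    ∫ ω, rejShare α lam e A j (fun i => p i ω) * lowShare α lam e A k (fun i => p i ω) ∂P =
      ∫ ω, lowShare α lam e A j (fun i => p i ω) * lowShare α lam e A k (fun i => p i ω) ∂P := by
  rw [H.integral_rejShare_mul hα hl hl1 hp hj (H.measurable_lowShare k)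
    (H.lowShare_nonneg hα hl k) (H.lowShare_le_one hα hl k)
    fun x hx hr => H.lowShare_update hl (hr.trans (min_le_right _ _)) k]
  refine integral_congr_ae (Eventually.of_forall fun ω => ?_)
  by_cases h : p j ω ≤ lam
  · simp only [H.lowShare_update (x := fun i => p i ω) hl h k]
  · have : lowShare α lam e A j (fun i => p i ω) = 0 := if_neg fun hr => h hr.2
    simp only [this, zero_mul]

lemma Admissible.integral_rejShare_mul_self (H : Admissible α lam e A) (hα : 0 < α)
    (hl : 0 < lam) (hl1 : lam ≤ 1) (hp : BasicIndependence P I p) {j : Fin m} (hj : j ∈ I) :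
    ∫ ω, rejShare α lam e A j (fun i => p i ω) * rejShare α lam e A j (fun i => p i ω) ∂P =
      ∫ ω, lowShare α lam e A j (fun i => p i ω) *
        rejShare α lam e A j (Function.update (fun i => p i ω) j 0) ∂P :=
  H.integral_rejShare_mul hα hl hl1 hp hj (H.measurable_rejShare j) (rejShare_nonneg j)
    (rejShare_le_one j) fun _ hx hr => H.rejShare_update hα hl hx hr j

/-- Two averagings: over coordinate `j`, which leaves the `k`-th share at the vector with `x j`
frozen at 0, and then over coordinate `k`. -/
lemma Admissible.integral_rejShare_mul_rejShare (H : Admissible α lam e A) (hα : 0 < α)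
    (hl : 0 < lam) (hl1 : lam ≤ 1) (hp : BasicIndependence P I p) {j k : Fin m} (hj : j ∈ I)
    (hk : k ∈ I) (hjk : j ≠ k) :
    ∫ ω, rejShare α lam e A j (fun i => p i ω) * rejShare α lam e A k (fun i => p i ω) ∂P =
      ∫ ω, lowShare α lam e A j (fun i => p i ω) * lowShare α lam e A k (fun i => p i ω) ∂P := by
  rw [H.integral_rejShare_mul hα hl hl1 hp hj (H.measurable_rejShare k) (rejShare_nonneg k)
    (rejShare_le_one k) fun x hx hr => H.rejShare_update hα hl hx hr k]
  refine hp.integral_congr_average hk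
    (f := fun x => lowShare α lam e A j x * rejShare α lam e A k (Function.update x j 0))
    (g := fun x => lowShare α lam e A j x * lowShare α lam e A k x) (B := 1)
    ((H.measurable_lowShare j).mul ((H.measurable_rejShare k).comp (measurable_update_zero j)))
    ((H.measurable_lowShare j).mul (H.measurable_lowShare k)) ?_ ?_ ?_
  · exact fun x => abs_mul_le_one (H.lowShare_nonneg hα hl j x) (H.lowShare_le_one hα hl j x)
      (rejShare_nonneg k _) (rejShare_le_one k _)
  · exact fun x => abs_mul_le_one (H.lowShare_nonneg hα hl j x) (H.lowShare_le_one hα hl j x)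
      (H.lowShare_nonneg hα hl k x) (H.lowShare_le_one hα hl k x)
  · intro x _
    by_cases hxj : x j ≤ lam
    -- When x_j ≤ λ, the low shares do not notice freezing `x j` at 0, so the whole integrand lives
    -- on the frozen vector. Otherwise both sides vanish.
    · have hu : ∀ u, Function.update x k u j ≤ lam := fun u => by
        rwa [Function.update_of_ne hjk]
      have h1 : ∀ u i, lowShare α lam e A i (Function.update x k u) =
          lowShare α lam e A i (Function.update (Function.update x j 0) k u) := fun u i => by
        rw [Function.update_comm hjk, H.lowShare_update hl (hu u) i]
      have h2 : ∀ u, Function.update (Function.update x k u) j 0 =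
          Function.update (Function.update x j 0) k u := fun u => by
        rw [Function.update_comm hjk]
      have key := H.average_rejShare_mul hα hl hl1 k (ψ := lowShare α lam e A j)
        (fun x hx hr => H.lowShare_update hl (hr.trans (min_le_right _ _)) j)
        (Function.update x j 0)
      simp only [h1, h2]
      simp only [mul_comm (lowShare α lam e A j _)]
      rw [key]
      refine integral_congr_ae (Eventually.of_forall fun u => ?_)
      beta_reduce
      by_cases huk : u ≤ lam
      · rw [H.lowShare_update hl (by simpa using huk) j]
      · have : lowShare α lam e A k (Function.update (Function.update x j 0) k u) = 0 :=
          if_neg fun hr => huk (by simpa using hr.2)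
        rw [this, zero_mul, zero_mul]
    · have h1 : ∀ u, lowShare α lam e A j (Function.update x k u) = 0 := fun u =>
        if_neg fun hr => hxj (by simpa [Function.update_of_ne hjk] using hr.2)
      simp [h1]

/-- The second moment of the difference of the false discovery proportion and its conditional
expectation given the `p`-values exceeding `lam`, on the event `A`. -/
lemma Admissible.integral_sq_sum_sub (H : Admissible α lam e A) (hα : 0 < α)
    (hl : 0 < lam) (hl1 : lam ≤ 1) (hp : BasicIndependence P I p) :
    ∫ ω, (∑ j ∈ I, (rejShare α lam e A j (fun i => p i ω) -
        lowShare α lam e A j (fun i => p i ω))) ^ 2 ∂P =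
      ∑ j ∈ I, (∫ ω, rejShare α lam e A j (fun i => p i ω) ^ 2 ∂P -
        ∫ ω, lowShare α lam e A j (fun i => p i ω) ^ 2 ∂P) := by
  set D : Fin m → Ω → ℝ := fun j ω => rejShare α lam e A j (fun i => p i ω) with hD
  set L : Fin m → Ω → ℝ := fun j ω => lowShare α lam e A j (fun i => p i ω) with hL
  have hDm : ∀ j, Measurable (D j) := fun j => (H.measurable_rejShare j).comp hp.measurable_pi
  have hLm : ∀ j, Measurable (L j) := fun j => (H.measurable_lowShare j).comp hp.measurable_pi
  have iDD : ∀ j k, Integrable (fun ω => D j ω * D k ω) P := fun j k =>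
    Integrable.of_bound ((hDm j).mul (hDm k)).aestronglyMeasurable 1
      (Eventually.of_forall fun ω => abs_mul_le_one (rejShare_nonneg _ _) (rejShare_le_one _ _)
        (rejShare_nonneg _ _) (rejShare_le_one _ _))
  have iDL : ∀ j k, Integrable (fun ω => D j ω * L k ω) P := fun j k =>
    Integrable.of_bound ((hDm j).mul (hLm k)).aestronglyMeasurable 1
      (Eventually.of_forall fun ω => abs_mul_le_one (rejShare_nonneg _ _) (rejShare_le_one _ _)
        (H.lowShare_nonneg hα hl _ _) (H.lowShare_le_one hα hl _ _))
  have iLL : ∀ j k, Integrable (fun ω => L j ω * L k ω) P := fun j k =>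
    Integrable.of_bound ((hLm j).mul (hLm k)).aestronglyMeasurable 1
      (Eventually.of_forall fun ω => abs_mul_le_one
        (H.lowShare_nonneg hα hl _ _) (H.lowShare_le_one hα hl _ _)
        (H.lowShare_nonneg hα hl _ _) (H.lowShare_le_one hα hl _ _))
  have hexp : ∀ ω, (∑ j ∈ I, (D j ω - L j ω)) ^ 2 = ∑ j ∈ I, ∑ k ∈ I,
      ((D j ω * D k ω - D j ω * L k ω) - (D k ω * L j ω - L j ω * L k ω)) := fun ω => by
    rw [sq, Finset.sum_mul_sum]
    exact Finset.sum_congr rfl fun j _ => Finset.sum_congr rfl fun k _ => by ring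
  have hint : ∀ j k, Integrable (fun ω =>
      (D j ω * D k ω - D j ω * L k ω) - (D k ω * L j ω - L j ω * L k ω)) P := fun j k =>
    ((iDD j k).sub (iDL j k)).sub ((iDL k j).sub (iLL j k))
  calc ∫ ω, (∑ j ∈ I, (D j ω - L j ω)) ^ 2 ∂P
      = ∑ j ∈ I, ∑ k ∈ I, ∫ ω, ((D j ω * D k ω - D j ω * L k ω) -
          (D k ω * L j ω - L j ω * L k ω)) ∂P := by
        simp only [hexp]
        rw [integral_finsetSum _ fun j _ => integrable_finsetSum _ fun k _ => hint j k]
        exact Finset.sum_congr rfl fun j _ => integral_finsetSum _ fun k _ => hint j k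
    -- All of E D_jL_k, E D_kL_j and, off the diagonal, E D_jD_k equal E L_jL_k.
    _ = ∑ j ∈ I, ∑ k ∈ I, if j = k then ∫ ω, D j ω ^ 2 ∂P - ∫ ω, L j ω ^ 2 ∂P else 0 := by
        refine Finset.sum_congr rfl fun j hj => Finset.sum_congr rfl fun k hk => ?_
        rw [integral_sub (f := fun ω => D j ω * D k ω - D j ω * L k ω)
            (g := fun ω => D k ω * L j ω - L j ω * L k ω)
            ((iDD j k).sub (iDL j k)) ((iDL k j).sub (iLL j k)),
          integral_sub (iDD j k) (iDL j k), integral_sub (iDL k j) (iLL j k)]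
        have e1 : ∫ ω, D j ω * L k ω ∂P = ∫ ω, L j ω * L k ω ∂P :=
          H.integral_rejShare_mul_lowShare hα hl hl1 hp hj k
        have e2 : ∫ ω, D k ω * L j ω ∂P = ∫ ω, L j ω * L k ω ∂P :=
          (H.integral_rejShare_mul_lowShare hα hl hl1 hp hk j).trans
            (integral_congr_ae (Eventually.of_forall fun ω => mul_comm _ _))
        rw [e1, e2, sub_self, sub_zero]
        split_ifs with hjk
        · subst hjk; simp only [sq]
        · have e3 : ∫ ω, D j ω * D k ω ∂P = ∫ ω, L j ω * L k ω ∂P :=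
            H.integral_rejShare_mul_rejShare hα hl hl1 hp hj hk hjk
          rw [e3, sub_self]
    _ = _ := Finset.sum_congr rfl fun j hj => by simp [hj, hD, hL]

end Expectation

lemma sum_rejShare {I : Finset (Fin m)} {x : Fin m → ℝ} (hx : x ∈ A) :
    ∑ j ∈ I, rejShare α lam e A j x = FDP (critAdaptive α lam (e x)) I x := by
  simp only [rejShare, hx, true_and, FDP, stepUpV, Finset.card_filter, Nat.cast_sum,
    Finset.sum_div, adaptiveR]
  exact Finset.sum_congr rfl fun j _ => by split_ifs <;> simp

lemma sum_lowShare {I : Finset (Fin m)} {x : Fin m → ℝ} (hx : x ∈ A) :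
    ∑ j ∈ I, lowShare α lam e A j x =
      ((I.filter fun j => x j ≤ lam).card : ℝ) * (α / (lam * e x)) := by
  simp only [lowShare, hx, true_and]
  rw [← Finset.sum_filter, Finset.sum_const, nsmul_eq_mul]

end Shares

/-! ### Second moment bounds: comparison with BH, and the count of true nulls. -/

section Bounds

variable {m : ℕ}

lemma ecdf_update_zero {lam : ℝ} (hl : 0 ≤ lam) {x : Fin m → ℝ} {j : Fin m} (hj : x j ≤ lam)
    (t : Set.Ici lam) : ecdf (Function.update x j 0) t = ecdf x t := by
  rw [ecdf, ecdf, countLE_update_zero_eq x j (hl.trans t.2) (hj.trans t.2)]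

lemma measurable_countLE_left (t : ℝ) : Measurable fun x : Fin m → ℝ => countLE x t :=
  measurable_countLE.comp (measurable_id.prodMk measurable_const)

lemma measurable_estimate {lam : ℝ} {g : (Set.Ici lam → ℝ) → ℝ} (hg : Measurable g) :
    Measurable (estimate (m := m) g) := by
  refine hg.comp (measurable_pi_iff.2 fun t => ?_)
  exact (measurable_from_nat.comp (measurable_countLE_left _)).div_const _

/-- The Benjamini-Hochberg test as an admissible adaptive test. -/
lemma admissible_const {α : ℝ} (hα1 : α ≤ 1) (hm : 1 ≤ m) :
    Admissible α 1 (fun _ : Fin m → ℝ => (m : ℝ)) Set.univ where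
  measurable := measurable_const
  measurableSet := MeasurableSet.univ
  estimator_update _ _ _ := rfl
  event_update _ _ _ := Iff.rfl
  le_estimator x _ := by
    have h : max (countLE x 1 : ℝ) 1 ≤ m :=
      max_le (by exact_mod_cast countLE_le x 1) (by exact_mod_cast hm)
    have h0 : (0 : ℝ) ≤ max (countLE x 1 : ℝ) 1 := le_max_of_le_right zero_le_one
    rw [div_one]
    nlinarith

/-- The event on which an estimator is neither too small nor larger than `m`. -/
def goodEvent (α lam : ℝ) (e : (Fin m → ℝ) → ℝ) (d : ℝ) : Set (Fin m → ℝ) :=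
  {x | α / lam * max (countLE x lam : ℝ) 1 ≤ e x ∧ d * m ≤ e x ∧ e x ≤ m}

lemma admissible_estimate {α lam : ℝ} (hl : 0 ≤ lam) {g : (Set.Ici lam → ℝ) → ℝ}
    (hg : Measurable g) (d : ℝ) :
    Admissible α lam (estimate g) (goodEvent α lam (estimate (m := m) g) d) where
  measurable := measurable_estimate hg
  measurableSet := by
    have h := measurable_estimate (m := m) hg
    have h2 : Measurable fun x : Fin m → ℝ => (countLE x lam : ℝ) :=
      measurable_from_nat.comp (measurable_countLE_left _)
    exact (measurableSet_le (by fun_prop) h).inter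
      ((measurableSet_le measurable_const h).inter (measurableSet_le h measurable_const))
  estimator_update x j hj := by simp only [estimate, ecdf_update_zero hl hj]
  event_update x j hj := by
    simp only [goodEvent, Set.mem_ofPred_eq, countLE_update_zero_eq x j hl hj, estimate,
      ecdf_update_zero hl hj]
  le_estimator x hx := hx.1

section Expectation

variable {Ω : Type*} [MeasurableSpace Ω] {P : Measure Ω} [IsProbabilityMeasure P]
  {I : Finset (Fin m)} {p : Fin m → Ω → ℝ}

lemma Admissible.integrable_mul_rejShare {α lam : ℝ} {e : (Fin m → ℝ) → ℝ} {A : Set (Fin m → ℝ)}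
    (H : Admissible α lam e A) (hα : 0 < α) (hl : 0 < lam) (hp : BasicIndependence P I p)
    (j : Fin m) :
    Integrable (fun ω => lowShare α lam e A j (fun i => p i ω) *
      rejShare α lam e A j (Function.update (fun i => p i ω) j 0)) P := by
  refine Integrable.of_bound (Measurable.aestronglyMeasurable ?_) 1
    (Eventually.of_forall fun ω => abs_mul_le_one (H.lowShare_nonneg hα hl _ _)
      (H.lowShare_le_one hα hl _ _) (rejShare_nonneg _ _) (rejShare_le_one _ _))
  exact ((H.measurable_lowShare j).comp hp.measurable_pi).mul
    ((H.measurable_rejShare j).comp ((measurable_update_zero j).comp hp.measurable_pi))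

/-- For BH the compensating share is deterministic, which is what turns the second moment identity
into a variance. -/
lemma lowShare_const {α : ℝ} {x : Fin m → ℝ} {j : Fin m} (hx : x j ≤ 1) :
    lowShare α 1 (fun _ : Fin m → ℝ => (m : ℝ)) Set.univ j x = α / m := by
  rw [lowShare, if_pos ⟨Set.mem_univ _, hx⟩, one_mul]

/-- The adaptive test makes at least as many rejections as the Benjamini-Hochberg test when the
estimator is at most `m`. -/
lemma adaptiveR_const_le {α lam : ℝ} (hα : 0 ≤ α) (hαlam : α ≤ lam) {e : (Fin m → ℝ) → ℝ}
    {x : Fin m → ℝ} (he : 0 < e x) (hem : e x ≤ m) :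
    adaptiveR α 1 (fun _ : Fin m → ℝ => (m : ℝ)) x ≤ adaptiveR α lam e x := by
  refine stepUpR_mono_crit fun i hi => le_trans ?_ (critAdaptive_anti hα he hem i)
  have h : (i : ℝ) / m ≤ 1 := div_le_one_of_le₀ (by exact_mod_cast hi) (by positivity)
  refine le_min (min_le_left _ _) ((min_le_left _ _).trans ?_)
  nlinarith

/-- Averaging one factor gives E D_j² = E(L_j/R), with R at the vector with p_j lowered to 0, on the
good event. There m̂₀ ≥ dm bounds `L_j` by 1/(λd) times the BH value α/m, and m̂₀ ≤ m makes 1/R at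
most its BH counterpart. -/
lemma integral_rejShare_sq_le {α lam d : ℝ} (hα : 0 < α) (hαlam : α ≤ lam) (hl1 : lam ≤ 1)
    (hd : 0 < d) (hm : 1 ≤ m) {g : (Set.Ici lam → ℝ) → ℝ} (hg : Measurable g)
    (hp : BasicIndependence P I p) {j : Fin m} (hj : j ∈ I) :
    ∫ ω, rejShare α lam (estimate g) (goodEvent α lam (estimate g) d) j (fun i => p i ω) ^ 2 ∂P ≤
      1 / (lam * d) * ∫ ω, rejShare α 1 (fun _ => (m : ℝ)) Set.univ j (fun i => p i ω) ^ 2 ∂P := by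
  have hl : 0 < lam := hα.trans_le hαlam
  have hm0 : (0 : ℝ) < m := by exact_mod_cast hm
  have H := admissible_estimate (α := α) (m := m) hl.le hg d
  have H' := admissible_const (m := m) (hαlam.trans hl1) hm
  simp only [sq]
  rw [H.integral_rejShare_mul_self hα hl hl1 hp hj,
    H'.integral_rejShare_mul_self hα one_pos le_rfl hp hj, ← integral_const_mul]
  refine integral_mono (H.integrable_mul_rejShare hα hl hp j)
    ((H'.integrable_mul_rejShare hα one_pos hp j).const_mul _) fun ω => ?_
  beta_reduce
  set x : Fin m → ℝ := fun i => p i ω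
  have hnn : 0 ≤ 1 / (lam * d) * (lowShare α 1 (fun _ => (m : ℝ)) Set.univ j x *
      rejShare α 1 (fun _ => (m : ℝ)) Set.univ j (Function.update x j 0)) :=
    mul_nonneg (by positivity)
      (mul_nonneg (H'.lowShare_nonneg hα one_pos _ _) (rejShare_nonneg _ _))
  by_cases hx : x ∈ goodEvent α lam (estimate g) d ∧ x j ≤ lam
  · rw [lowShare_const (hp.mem_Icc j ω).2, lowShare, if_pos hx, ← mul_assoc]
    have hy := (H.event_update x j hx.2).2 hx.1
    have hye := H.pos hα hl hy
    have hR := H'.one_le_adaptiveR hα one_pos (Set.mem_univ (Function.update x j 0))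
    have hRR := adaptiveR_const_le hα.le hαlam (e := estimate g) hye hy.2.2
    have hR0 : (0 : ℝ) < adaptiveR α 1 (fun _ : Fin m → ℝ => (m : ℝ)) (Function.update x j 0) := by
      exact_mod_cast hR
    refine mul_le_mul ?_ ?_ (rejShare_nonneg _ _) (by positivity)
    · calc α / (lam * estimate g x) ≤ α / (lam * (d * m)) := by
            have := hx.1.2.1
            gcongr
        _ = 1 / (lam * d) * (α / m) := by field_simp
    · have h2 : rejShare α 1 (fun _ => (m : ℝ)) Set.univ j (Function.update x j 0) =
          1 / (adaptiveR α 1 (fun _ : Fin m → ℝ => (m : ℝ)) (Function.update x j 0) : ℝ) := by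
        refine if_pos ⟨Set.mem_univ _, ?_⟩
        rw [Function.update_self]
        exact critAdaptive_nonneg hα.le zero_le_one hm0.le _
      rw [h2, rejShare, if_pos ⟨hy, by
        rw [Function.update_self]; exact critAdaptive_nonneg hα.le hl.le hye.le _⟩]
      exact one_div_le_one_div_of_le hR0 (by exact_mod_cast hRR)
  · rw [lowShare, if_neg hx, zero_mul]
    exact hnn

/-- The second moment of the Benjamini-Hochberg false discovery proportion. -/
lemma sum_integral_rejShare_const_sq {α : ℝ} (hα : 0 < α) (hα1 : α ≤ 1) (hm : 1 ≤ m)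
    (hp : BasicIndependence P I p) :
    ∑ j ∈ I, ∫ ω, rejShare α 1 (fun _ => (m : ℝ)) Set.univ j (fun i => p i ω) ^ 2 ∂P =
      ∫ ω, (FDP (critBH α m) I (fun i => p i ω) -
        ∫ ω', FDP (critBH α m) I (fun i => p i ω') ∂P) ^ 2 ∂P + I.card * (α / m) ^ 2 := by
  have H := admissible_const (m := m) hα1 hm
  have hFDP : ∀ x, FDP (critBH α m) I x =
      ∑ j ∈ I, rejShare α 1 (fun _ => (m : ℝ)) Set.univ j x := fun x => by
    rw [sum_rejShare (Set.mem_univ x)]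
    exact FDP_congr (fun i hi => critBH_eq_critAdaptive hα.le hα1 hi) I x
  have hlow : ∀ j ω, lowShare α 1 (fun _ => (m : ℝ)) Set.univ j (fun i => p i ω) = α / m :=
    fun j ω => lowShare_const (x := fun i => p i ω) (hp.mem_Icc j ω).2
  have hint : ∀ j, Integrable
      (fun ω => rejShare α 1 (fun _ => (m : ℝ)) Set.univ j (fun i => p i ω)) P := fun j =>
    Integrable.of_bound ((H.measurable_rejShare j).comp hp.measurable_pi).aestronglyMeasurable 1
      (Eventually.of_forall fun ω => by
        rw [Real.norm_eq_abs, abs_of_nonneg (rejShare_nonneg _ _)]; exact rejShare_le_one _ _)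
  have hmean : ∫ ω', FDP (critBH α m) I (fun i => p i ω') ∂P = ∑ _j ∈ I, α / m := by
    simp only [hFDP]
    rw [integral_finsetSum _ fun j _ => hint j]
    refine Finset.sum_congr rfl fun j hj => ?_
    -- With constant `ψ` the averaging identity gives the mean α/m of each BH share.
    have h := H.integral_rejShare_mul hα one_pos le_rfl hp hj (ψ := fun _ => 1)
      measurable_const (fun _ => zero_le_one) (fun _ => le_rfl) fun _ _ _ => rfl
    simpa [hlow] using h
  have h := H.integral_sq_sum_sub hα one_pos le_rfl hp
  simp only [hlow, Finset.sum_sub_distrib, ← hFDP, ← hmean] at h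
  rw [h]
  simp

lemma integral_sq_sum_sub_le {α lam d : ℝ} (hα : 0 < α) (hαlam : α ≤ lam) (hl1 : lam ≤ 1)
    (hd : 0 < d) (hm : 1 ≤ m) {g : (Set.Ici lam → ℝ) → ℝ} (hg : Measurable g)
    (hp : BasicIndependence P I p) :
    ∫ ω, (∑ j ∈ I, (rejShare α lam (estimate g) (goodEvent α lam (estimate g) d) j
        (fun i => p i ω) - lowShare α lam (estimate g) (goodEvent α lam (estimate g) d) j
        (fun i => p i ω))) ^ 2 ∂P ≤
      1 / (lam * d) * (∫ ω, (FDP (critBH α m) I (fun i => p i ω) -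
        ∫ ω', FDP (critBH α m) I (fun i => p i ω') ∂P) ^ 2 ∂P + 1 / m) := by
  have hl : 0 < lam := hα.trans_le hαlam
  have hm0 : (0 : ℝ) < m := by exact_mod_cast hm
  rw [(admissible_estimate (α := α) (m := m) hl.le hg d).integral_sq_sum_sub hα hl hl1 hp]
  calc _ ≤ ∑ j ∈ I, 1 / (lam * d) *
        ∫ ω, rejShare α 1 (fun _ => (m : ℝ)) Set.univ j (fun i => p i ω) ^ 2 ∂P :=
        Finset.sum_le_sum fun j hj => (sub_le_self _ (integral_nonneg fun _ => sq_nonneg _)).trans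
          (integral_rejShare_sq_le hα hαlam hl1 hd hm hg hp hj)
    _ ≤ _ := by
        rw [← Finset.mul_sum, sum_integral_rejShare_const_sq hα (hαlam.trans hl1) hm hp]
        gcongr
        have h1 : (I.card : ℝ) ≤ m := by exact_mod_cast (Finset.card_le_univ I).trans (by simp)
        have h2 : α ^ 2 ≤ 1 := pow_le_one₀ hα.le (hαlam.trans hl1)
        calc (I.card : ℝ) * (α / m) ^ 2 ≤ m * (α / m) ^ 2 := by gcongr
          _ = α ^ 2 / m := by field_simp
          _ ≤ 1 / m := by gcongr

/-- The variance bound for the number of true null `p`-values that are at most `t`. -/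
lemma BasicIndependence.integral_sq_count_le (hp : BasicIndependence P I p) (hm : 1 ≤ m) {t : ℝ}
    (ht : t ∈ Set.Icc (0 : ℝ) 1) :
    ∫ ω, (((I.filter fun j => p j ω ≤ t).card : ℝ) / m - (I.card : ℝ) / m * t) ^ 2 ∂P ≤ 1 / m := by
  have hm0 : (0 : ℝ) < m := by exact_mod_cast hm
  have hφ : Measurable fun s : ℝ => if s ≤ t then (1 : ℝ) else 0 :=
    Measurable.ite measurableSet_Iic measurable_const measurable_const
  set X : {j // j ∈ I} → Ω → ℝ := fun j ω => if p j.1 ω ≤ t then 1 else 0 with hX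
  have hXm : ∀ j, Measurable (X j) := fun j => hφ.comp (hp.measurable j.1)
  have hXL : ∀ j, MemLp (X j) 2 P := fun j =>
    MemLp.of_bound (hXm j).aestronglyMeasurable 1 (Eventually.of_forall fun ω => by
      simp only [hX]; split_ifs <;> simp)
  have hmean : ∀ j, ∫ ω, X j ω ∂P = t := fun j => by
    have h : X j = {ω | p j.1 ω ≤ t}.indicator fun _ => (1 : ℝ) := by
      funext ω; simp [hX, Set.indicator]
    rw [h, integral_indicator_const _ (measurableSet_le (hp.measurable j.1) measurable_const),
      Measure.real, hp.uniform j.1 j.2 t ht]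
    simp [ht.1]
  have hsum : ∀ ω, ((I.filter fun j => p j ω ≤ t).card : ℝ) = (∑ j, X j) ω := fun ω => by
    rw [Finset.sum_apply, Finset.card_filter, Nat.cast_sum, ← Finset.sum_coe_sort]
    exact Finset.sum_congr rfl fun j _ => by simp [hX]
  have hvar : Var[∑ j, X j; P] ≤ m := by
    rw [IndepFun.variance_sum (fun j _ => hXL j) fun i _ j _ hij =>
      (hp.indep_true.indepFun hij).comp hφ hφ]
    calc ∑ j, Var[X j; P] ≤ ∑ _j : {j // j ∈ I}, (1 : ℝ) := by
          refine Finset.sum_le_sum fun j _ =>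
            (variance_le_expectation_sq (hXm j).aestronglyMeasurable).trans ?_
          -- An indicator equals its square, so its second moment is its mean `t`, at most 1.
          have : (X j) ^ 2 = X j := by
            funext ω; simp only [hX, Pi.pow_apply]; split_ifs <;> simp
          rw [this, hmean j]; exact ht.2
      _ = (I.card : ℝ) := by simp
      _ ≤ m := by exact_mod_cast (Finset.card_le_univ I).trans (by simp)
  have hmeansum : ∫ ω, (∑ j, X j) ω ∂P = I.card * t := by
    simp only [Finset.sum_apply]
    rw [integral_finsetSum _ fun j _ => (hXL j).integrable one_le_two]
    simp [hmean]
  rw [variance_eq_integral (Finset.aemeasurable_sum _ fun j _ => (hXm j).aemeasurable),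
    hmeansum] at hvar
  have : ∀ ω, (((I.filter fun j => p j ω ≤ t).card : ℝ) / m - (I.card : ℝ) / m * t) ^ 2 =
      1 / (m : ℝ) ^ 2 * ((∑ j, X j) ω - I.card * t) ^ 2 := fun ω => by
    rw [hsum]; field_simp
  simp only [this]
  rw [integral_const_mul]
  calc _ ≤ 1 / (m : ℝ) ^ 2 * m := by gcongr
    _ = 1 / m := by field_simp

end Expectation

end Bounds

/-! ### Convergence in probability, moments and consistency. -/

section InProbability

variable {Ω : ℕ → Type*} [∀ m, MeasurableSpace (Ω m)] {P : ∀ m, Measure (Ω m)}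

lemma tendsto_measure_zero_of_subset_union {s t u : ∀ m, Set (Ω m)}
    (h : ∀ᶠ m in atTop, s m ⊆ t m ∪ u m)
    (ht : Tendsto (fun m => P m (t m)) atTop (𝓝 0))
    (hu : Tendsto (fun m => P m (u m)) atTop (𝓝 0)) :
    Tendsto (fun m => P m (s m)) atTop (𝓝 0) := by
  refine tendsto_of_tendsto_of_tendsto_of_le_of_le' tendsto_const_nhds
    (by simpa using ht.add hu) (Eventually.of_forall fun _ => zero_le) ?_
  filter_upwards [h] with m hm
  exact (measure_mono hm).trans (measure_union_le _ _)

lemma TendstoInProb.add_const_seq {X : ∀ m, Ω m → ℝ} {a : ℕ → ℝ} {b : ℝ}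
    (hX : TendstoInProb P (fun m ω => X m ω - a m) 0) (ha : Tendsto a atTop (𝓝 b)) :
    TendstoInProb P X b := by
  intro ε hε
  refine tendsto_measure_zero_of_subset_union (u := fun _ => ∅) ?_ (hX (ε / 2) (half_pos hε))
    (by simp)
  filter_upwards [ha (Metric.ball_mem_nhds b (half_pos hε))] with m hm ω hω
  left
  simp only [Set.mem_ofPred_eq, sub_zero] at hω ⊢
  have h1 : |a m - b| < ε / 2 := hm
  have h2 : |X m ω - b| ≤ |X m ω - a m| + |a m - b| := abs_sub_le _ _ _
  linarith

lemma TendstoInProb.comp₂ {X Y : ∀ m, Ω m → ℝ} {a b : ℝ} (hX : TendstoInProb P X a)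
    (hY : TendstoInProb P Y b) {F : ℝ × ℝ → ℝ} (hF : ContinuousAt F (a, b)) :
    TendstoInProb P (fun m ω => F (X m ω, Y m ω)) (F (a, b)) := by
  intro ε hε
  obtain ⟨δ, hδ, h⟩ := Metric.continuousAt_iff.1 hF ε hε
  refine tendsto_measure_zero_of_subset_union (Eventually.of_forall fun m ω hω => ?_)
    (hX δ hδ) (hY δ hδ)
  by_contra hcon
  simp only [Set.mem_union, Set.mem_ofPred_eq, not_or, not_le] at hcon hω
  have h2 := h (x := (X m ω, Y m ω)) (by
    rw [Prod.dist_eq]; exact max_lt hcon.1 hcon.2)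
  rw [Real.dist_eq] at h2
  linarith

lemma tendstoInProb_zero_of_integral_sq [∀ m, IsProbabilityMeasure (P m)] {X : ∀ m, Ω m → ℝ}
    (hint : ∀ᶠ m in atTop, Integrable (fun ω => X m ω ^ 2) (P m))
    (h : Tendsto (fun m => ∫ ω, X m ω ^ 2 ∂(P m)) atTop (𝓝 0)) : TendstoInProb P X 0 := by
  intro ε hε
  have h1 : Tendsto (fun m => ENNReal.ofReal ((∫ ω, X m ω ^ 2 ∂(P m)) / ε ^ 2)) atTop (𝓝 0) := by
    have := ENNReal.tendsto_ofReal (h.div_const (ε ^ 2))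
    simpa using this
  refine tendsto_of_tendsto_of_tendsto_of_le_of_le' tendsto_const_nhds h1
    (Eventually.of_forall fun _ => zero_le) ?_
  filter_upwards [hint] with m hm
  have hset : {ω | ε ≤ |X m ω - 0|} = {ω | ε ^ 2 ≤ X m ω ^ 2} := by
    ext ω
    simp only [sub_zero, Set.mem_ofPred_eq]
    rw [← sq_abs (X m ω)]
    exact (pow_le_pow_iff_left₀ hε.le (abs_nonneg _) two_ne_zero).symm
  rw [hset, ← ofReal_measureReal]
  refine ENNReal.ofReal_le_ofReal ?_
  rw [le_div_iff₀ (by positivity), mul_comm]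
  exact mul_meas_ge_le_integral_of_nonneg (Eventually.of_forall fun _ => sq_nonneg _) hm _

/-- Bounded convergence in probability. -/
lemma TendstoInProb.tendsto_integral [∀ m, IsProbabilityMeasure (P m)] {X : ∀ m, Ω m → ℝ} {B : ℝ}
    (hX : TendstoInProb P X 0) (hm : ∀ᶠ m in atTop, Measurable (X m))
    (h0 : ∀ᶠ m in atTop, ∀ ω, 0 ≤ X m ω) (hB : ∀ᶠ m in atTop, ∀ ω, X m ω ≤ B) :
    Tendsto (fun m => ∫ ω, X m ω ∂(P m)) atTop (𝓝 0) := by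
  rw [Metric.tendsto_atTop']
  suffices ∀ ε > 0, ∀ᶠ m in atTop, ∫ ω, X m ω ∂(P m) < ε ∧ 0 ≤ ∫ ω, X m ω ∂(P m) by
    intro ε hε
    obtain ⟨N, hN⟩ := eventually_atTop.1 (this ε hε)
    refine ⟨N, fun n hn => ?_⟩
    rw [Real.dist_eq, sub_zero, abs_of_nonneg (hN n hn.le).2]
    exact (hN n hn.le).1
  intro ε hε
  have hr : Tendsto (fun m => ε / 2 + B * (P m).real {ω | ε / 2 ≤ |X m ω - 0|}) atTop
      (𝓝 (ε / 2)) := by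
    have h1 := (ENNReal.tendsto_toReal ENNReal.zero_ne_top).comp (hX (ε / 2) (half_pos hε))
    have h2 := (h1.const_mul B).const_add (ε / 2)
    simpa [Measure.real, Function.comp_def] using h2
  filter_upwards [hm, h0, hB, hr.eventually_lt_const (half_lt_self hε)] with m hm h0 hB hlt
  refine ⟨lt_of_le_of_lt ?_ hlt, integral_nonneg h0⟩
  have hs : MeasurableSet {ω | ε / 2 ≤ |X m ω - 0|} :=
    measurableSet_le measurable_const (by fun_prop)
  have hi : Integrable ({ω | ε / 2 ≤ |X m ω - 0|}.indicator fun _ => B) (P m) :=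
    (integrable_const B).indicator hs
  have hXi : Integrable (X m) (P m) := Integrable.of_bound hm.aestronglyMeasurable B
    (Eventually.of_forall fun ω => by rw [Real.norm_eq_abs, abs_of_nonneg (h0 ω)]; exact hB ω)
  calc ∫ ω, X m ω ∂(P m)
      ≤ ∫ ω, (ε / 2 + {ω | ε / 2 ≤ |X m ω - 0|}.indicator (fun _ => B) ω) ∂(P m) := by
        refine integral_mono hXi ((integrable_const _).add hi) fun ω => ?_
        by_cases hω : ω ∈ {ω | ε / 2 ≤ |X m ω - 0|}
        · simp only [Set.indicator_of_mem hω]; linarith [hB ω]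
        · simp only [Set.indicator_of_notMem hω, add_zero]
          simp only [sub_zero, Set.mem_ofPred_eq, not_le] at hω
          exact (le_abs_self _).trans hω.le
    _ = ε / 2 + B * (P m).real {ω | ε / 2 ≤ |X m ω - 0|} := by
        rw [integral_add (integrable_const _) hi, integral_indicator_const _ hs]
        simp [mul_comm]

/-- Bounded variables converging in probability to a constant are consistent. -/
lemma TendstoInProb.consistent [∀ m, IsProbabilityMeasure (P m)] {X : ∀ m, Ω m → ℝ} {c : ℝ}
    (hX : TendstoInProb P X c) (hm : ∀ᶠ m in atTop, Measurable (X m))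
    (h0 : ∀ᶠ m in atTop, ∀ ω, 0 ≤ X m ω) (h1 : ∀ᶠ m in atTop, ∀ ω, X m ω ≤ 1) :
    Consistent P X := by
  have hmean : Tendsto (fun m => ∫ ω, |X m ω - c| ∂(P m)) atTop (𝓝 0) := by
    refine TendstoInProb.tendsto_integral (B := 1 + |c|) (fun ε hε => ?_) ?_ ?_ ?_
    · simpa using hX ε hε
    · filter_upwards [hm] with m hm using by fun_prop
    · exact Eventually.of_forall fun m ω => abs_nonneg _
    · filter_upwards [h0, h1] with m h0 h1 ω
      refine (abs_sub _ _).trans ?_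
      rw [abs_of_nonneg (h0 ω)]
      linarith [h1 ω]
  have hlim : Tendsto (fun m => c - ∫ ω, X m ω ∂(P m)) atTop (𝓝 0) := by
    refine squeeze_zero_norm' ?_ hmean
    filter_upwards [hm, h0, h1] with m hm h0 h1
    have hXi : Integrable (X m) (P m) := Integrable.of_bound hm.aestronglyMeasurable 1
      (Eventually.of_forall fun ω => by rw [Real.norm_eq_abs, abs_of_nonneg (h0 ω)]; exact h1 ω)
    calc ‖c - ∫ ω, X m ω ∂(P m)‖ = ‖∫ ω, (X m ω - c) ∂(P m)‖ := by
          rw [integral_sub hXi (integrable_const _), norm_sub_rev]; simp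
      _ ≤ ∫ ω, ‖X m ω - c‖ ∂(P m) := norm_integral_le_integral_norm _
  refine TendstoInProb.add_const_seq (a := fun m => c - ∫ ω, X m ω ∂(P m)) (fun ε hε => ?_) hlim
  simpa using hX ε hε

/-- The variances of bounded consistent variables tend to zero. -/
lemma Consistent.tendsto_integral_sq [∀ m, IsProbabilityMeasure (P m)] {X : ∀ m, Ω m → ℝ}
    (hX : Consistent P X) (hm : ∀ᶠ m in atTop, Measurable (X m))
    (h0 : ∀ᶠ m in atTop, ∀ ω, 0 ≤ X m ω) (h1 : ∀ᶠ m in atTop, ∀ ω, X m ω ≤ 1) :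
    Tendsto (fun m => ∫ ω, (X m ω - ∫ ω', X m ω' ∂(P m)) ^ 2 ∂(P m)) atTop (𝓝 0) := by
  refine TendstoInProb.tendsto_integral (B := 1) (fun ε hε => ?_) ?_
    (Eventually.of_forall fun m ω => sq_nonneg _) ?_
  -- The minimum with 1 is used because |y| < min(ε, 1) forces y² ≤ |y| < ε.
  · have h := hX (min ε 1) (by positivity)
    refine tendsto_measure_zero_of_subset_union (u := fun _ => ∅)
      (Eventually.of_forall fun m ω hω => ?_) h (by simp)
    left
    simp only [sub_zero, Set.mem_ofPred_eq, abs_pow, sq_abs] at hω ⊢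
    by_contra! hlt
    have h2 := lt_min_iff.1 hlt
    rw [← sq_abs] at hω
    nlinarith [abs_nonneg (X m ω - ∫ ω', X m ω' ∂(P m))]
  · filter_upwards [hm] with m hm using by fun_prop
  · filter_upwards [hm, h0, h1] with m hm h0 h1 ω
    have hXi : Integrable (X m) (P m) := Integrable.of_bound hm.aestronglyMeasurable 1
      (Eventually.of_forall fun ω => by rw [Real.norm_eq_abs, abs_of_nonneg (h0 ω)]; exact h1 ω)
    have hE0 : 0 ≤ ∫ ω', X m ω' ∂(P m) := integral_nonneg h0
    have hE1 : ∫ ω', X m ω' ∂(P m) ≤ 1 := by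
      simpa using integral_mono hXi (integrable_const (1 : ℝ)) h1
    rw [sq_le_one_iff_abs_le_one, abs_le]
    constructor <;> linarith [h0 ω, h1 ω]

end InProbability

/-! ### Events of full limiting probability and the law of large numbers. -/

lemma tendsto_measure_compl_zero {Ω : ℕ → Type*} [∀ m, MeasurableSpace (Ω m)]
    {P : ∀ m, Measure (Ω m)} [∀ m, IsProbabilityMeasure (P m)] {s : ∀ m, Set (Ω m)}
    (hs : ∀ᶠ m in atTop, MeasurableSet (s m)) (h : Tendsto (fun m => P m (s m)) atTop (𝓝 1)) :
    Tendsto (fun m => P m (s m)ᶜ) atTop (𝓝 0) := by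
  have h1 : Tendsto (fun m => 1 - P m (s m)) atTop (𝓝 (1 - 1)) :=
    ENNReal.Tendsto.sub tendsto_const_nhds h (Or.inl ENNReal.one_ne_top)
  rw [tsub_self] at h1
  refine h1.congr' ?_
  filter_upwards [hs] with m hm using (prob_compl_eq_one_sub hm).symm

/-- The law of large numbers for the true null `p`-values that are at most `t`. -/
lemma tendstoInProb_count {Ω : ℕ → Type*} [∀ m, MeasurableSpace (Ω m)]
    {P : ∀ m, Measure (Ω m)} [∀ m, IsProbabilityMeasure (P m)]
    {I : ∀ m, Finset (Fin m)} {p : ∀ m, Fin m → Ω m → ℝ}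
    (hp : ∀ m, 2 ≤ m → BasicIndependence (P m) (I m) (p m)) {κ : ℝ}
    (hκ : Tendsto (fun m : ℕ => ((I m).card : ℝ) / m) atTop (𝓝 κ)) {t : ℝ}
    (ht : t ∈ Set.Icc (0 : ℝ) 1) :
    TendstoInProb P (fun m ω => (((I m).filter fun j => p m j ω ≤ t).card : ℝ) / m) (κ * t) := by
  have h2 : ∀ᶠ m : ℕ in atTop, 2 ≤ m := eventually_ge_atTop 2
  refine TendstoInProb.add_const_seq (a := fun m => ((I m).card : ℝ) / m * t) ?_
    (hκ.mul_const t)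
  refine tendstoInProb_zero_of_integral_sq ?_ ?_
  · filter_upwards [h2] with m hm
    have hmeas : Measurable fun ω => ((((I m).filter fun j => p m j ω ≤ t).card : ℝ)) := by
      simp only [Finset.card_filter, Nat.cast_sum]
      refine Finset.measurable_sum _ fun j _ => measurable_from_nat.comp
        (Measurable.ite (measurableSet_le ((hp m hm).measurable j) measurable_const)
          measurable_const measurable_const)
    have hcard : ∀ s : Finset (Fin m), (s.card : ℝ) / m ∈ Set.Icc (0 : ℝ) 1 := fun s =>
      ⟨by positivity, div_le_one_of_le₀
        (by exact_mod_cast (Finset.card_le_univ s).trans (by simp)) (by positivity)⟩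
    refine Integrable.of_bound (((hmeas.div_const _).sub_const _).pow_const 2).aestronglyMeasurable
      1 (Eventually.of_forall fun ω => ?_)
    have e1 := hcard ((I m).filter fun j => p m j ω ≤ t)
    have e2 := hcard (I m)
    have e3 : ((I m).card : ℝ) / m * t ∈ Set.Icc (0 : ℝ) 1 :=
      ⟨mul_nonneg e2.1 ht.1, mul_le_one₀ e2.2 ht.1 ht.2⟩
    rw [Real.norm_eq_abs, abs_pow, sq_abs, sq_le_one_iff_abs_le_one, abs_le]
    constructor <;> linarith [e1.1, e1.2, e3.1, e3.2]
  · refine squeeze_zero' (Eventually.of_forall fun m => integral_nonneg fun ω => sq_nonneg _) ?_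
      tendsto_one_div_atTop_nhds_zero_nat
    filter_upwards [h2] with m hm
    exact (hp m hm).integral_sq_count_le (by omega) ht

end AdaptiveTest

open AdaptiveTest
-- Consistency of the adaptive test.
theorem lemma5p4
    {Ω : ℕ → Type*} [∀ m, MeasurableSpace (Ω m)]
    (P : ∀ m, Measure (Ω m)) [∀ m, IsProbabilityMeasure (P m)]
    -- the true nulls and the p-values of the m-th testing problem
    (I₀ : ∀ m, Finset (Fin m)) (p : ∀ m, Fin m → Ω m → ℝ)
    (hBI : ∀ m, 2 ≤ m → BasicIndependence (P m) (I₀ m) (p m))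
    -- the level and the tuning parameter
    (α lam : ℝ) (hα : 0 < α) (hαlam : α ≤ lam) (hlam : lam < 1)
    -- the estimators: positive measurable functions of the empirical distribution function
    -- on the region to the right of the tuning parameter
    (g : ∀ _ : ℕ, (Set.Ici lam → ℝ) → ℝ) (hg : ∀ m, 2 ≤ m → Measurable (g m))
    (hpos : ∀ m, 2 ≤ m → ∀ ω, 0 < estimate (g m) (fun i => p m i ω))
    -- the proportion of true nulls converges to a positive limit
    (κ₀ : ℝ) (hκ₀ : κ₀ ∈ Set.Ioc (0 : ℝ) 1)
    (hA1 : Tendsto (fun m : ℕ => ((I₀ m).card : ℝ) / m) atTop (𝓝 κ₀))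
    -- the estimator is at most of order m
    (hA3 : ∃ K : ℝ, 0 < K ∧ ∀ m, 2 ≤ m → ∀ ω, estimate (g m) (fun i => p m i ω) ≤ K * m)
    -- the estimator is not too small, with probability tending to one
    (hA4 : ∃ C : ℝ, 1 < C ∧ Tendsto (fun m => P m {ω |
      C * α / lam * max (countLE (fun i => p m i ω) lam : ℝ) 1
        ≤ estimate (g m) (fun i => p m i ω)}) atTop (𝓝 1))
    (C₀ : ℝ) (hC₀ : C₀ ∈ Set.Icc (α * κ₀) 1)
    (hlim : TendstoInProb P (fun m ω => estimate (g m) (fun i => p m i ω) / m) C₀)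
    (hC₀one : C₀ = 1 → Tendsto (fun m : ℕ =>
      P m {ω | estimate (g m) (fun i => p m i ω) / m ≤ 1}) atTop (𝓝 1))
    -- the Benjamini-Hochberg test is consistent
    (hBH : Consistent P (fun m ω => FDP (critBH α m) (I₀ m) (fun i => p m i ω))) :
    -- the adaptive test is consistent
    Consistent P (fun m ω => FDP (critAdaptive α lam (estimate (g m) (fun i => p m i ω)))
      (I₀ m) (fun i => p m i ω)) := by
  have hl : 0 < lam := hα.trans_le hαlam
  have hC₀pos : 0 < C₀ := (mul_pos hα hκ₀.1).trans_le hC₀.1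
  have h2 : ∀ᶠ m : ℕ in atTop, 2 ≤ m := eventually_ge_atTop 2
  -- Since m̂₀/m → C₀ > 0, the lower bound C₀/2 holds with probability tending to one.
  set A : ∀ m, Set (Fin m → ℝ) := fun m => goodEvent α lam (estimate (g m)) (C₀ / 2)
  have hH : ∀ m, 2 ≤ m → Admissible α lam (estimate (m := m) (g m)) (A m) := fun m hm =>
    admissible_estimate hl.le (hg m hm) _
  have hem : ∀ m, 2 ≤ m → Measurable fun ω => estimate (g m) (fun i => p m i ω) := fun m hm =>
    (measurable_estimate (hg m hm)).comp (hBI m hm).measurable_pi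
  have hFDPm : ∀ᶠ m in atTop, Measurable fun ω =>
      FDP (critAdaptive α lam (estimate (g m) (fun i => p m i ω))) (I₀ m) (fun i => p m i ω) := by
    filter_upwards [h2] with m hm
    exact measurable_FDP (X := fun ω i => p m i ω)
      (c := fun ω => critAdaptive α lam (estimate (g m) (fun i => p m i ω)))
      (fun i => by have := hem m hm; unfold critAdaptive; fun_prop)
      (hBI m hm).measurable_pi _
  have hBHm : ∀ᶠ m in atTop, Measurable fun ω =>
      FDP (critBH α m) (I₀ m) (fun i => p m i ω) := by
    filter_upwards [h2] with m hm
    exact measurable_FDP (c := fun _ => critBH α m) (X := fun ω i => p m i ω)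
      (fun i => measurable_const) (hBI m hm).measurable_pi _
  -- the estimator is at most `m`, with probability tending to one
  have hle : Tendsto (fun m : ℕ => P m {ω | estimate (g m) (fun i => p m i ω) / m ≤ 1}ᶜ) atTop
      (𝓝 0) := by
    -- For C₀ < 1 the limit alone keeps m̂₀/m below 1; for C₀ = 1 it does not, and the additional
    -- assumption takes over.
    rcases hC₀.2.eq_or_lt with h1 | h1
    · refine tendsto_measure_compl_zero ?_ (hC₀one h1)
      filter_upwards [h2] with m hm
      exact measurableSet_le ((hem m hm).div_const _) measurable_const
    · refine tendsto_measure_zero_of_subset_union (u := fun _ => ∅)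
        (Eventually.of_forall fun m ω hω => ?_) (hlim (1 - C₀) (by linarith)) (by simp)
      left
      have h3 : 1 < estimate (g m) (fun i => p m i ω) / m := not_le.1 hω
      exact le_trans (by linarith) (le_abs_self (estimate (g m) (fun i => p m i ω) / m - C₀))
  have hgood : Tendsto (fun m => P m {ω | (fun i => p m i ω) ∉ A m}) atTop (𝓝 0) := by
    obtain ⟨C, hC, hA4⟩ := hA4
    have h4 := tendsto_measure_compl_zero (by
      filter_upwards [h2] with m hm
      refine measurableSet_le (Measurable.const_mul (Measurable.max ?_ measurable_const) _)
        (hem m hm)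
      exact measurable_from_nat.comp
        ((measurable_countLE_left _).comp (hBI m hm).measurable_pi)) hA4
    refine tendsto_measure_zero_of_subset_union ?_ h4
      (tendsto_measure_zero_of_subset_union (Eventually.of_forall fun m => subset_rfl)
        (hlim (C₀ / 2) (half_pos hC₀pos)) hle)
    filter_upwards [h2] with m hm ω hω
    by_contra hcon
    simp only [Set.mem_union, Set.mem_ofPred_eq, Set.mem_compl_iff, not_or, not_le]
      at hcon
    obtain ⟨hc1, hc2, hc3⟩ := hcon
    have hm0 : (0 : ℝ) < m := by exact_mod_cast (by omega : 0 < m)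
    refine hω ⟨le_trans ?_ (not_lt.1 hc1), ?_, ?_⟩
    · have h0 : (0 : ℝ) ≤ max (countLE (fun i => p m i ω) lam : ℝ) 1 :=
        le_max_of_le_right zero_le_one
      have h1 : α / lam ≤ C * α / lam := by
        gcongr; nlinarith
      gcongr
    · rw [← le_div_iff₀ hm0]
      linarith [(abs_lt.1 hc2).1]
    · rwa [not_lt, div_le_one hm0] at hc3
  -- the conditional expectation of the false discovery proportion
  have hcount := tendstoInProb_count hBI hA1 (t := lam) ⟨hl.le, hlam.le⟩
  have hW := hcount.comp₂ hlim (F := fun z => z.1 * (α / (lam * z.2))) (by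
    refine ContinuousAt.mul continuousAt_fst (continuousAt_const.div
      (continuousAt_const.mul continuousAt_snd) ?_)
    exact (mul_pos hl hC₀pos).ne')
  -- the false discovery proportion is close to its conditional expectation
  have hdiff : TendstoInProb P (fun m ω => ∑ j ∈ I₀ m,
      (rejShare α lam (estimate (g m)) (A m) j (fun i => p m i ω) -
        lowShare α lam (estimate (g m)) (A m) j (fun i => p m i ω))) 0 := by
    have hvar := hBH.tendsto_integral_sq hBHm
      (Eventually.of_forall fun m ω => FDP_nonneg _ _ _)
      (Eventually.of_forall fun m ω => FDP_le_one (critBH_mono hα.le m) _ _)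
    refine tendstoInProb_zero_of_integral_sq ?_ ?_
    · filter_upwards [h2] with m hm
      have hm' : Measurable fun ω => ∑ j ∈ I₀ m,
          (rejShare α lam (estimate (g m)) (A m) j (fun i => p m i ω) -
            lowShare α lam (estimate (g m)) (A m) j (fun i => p m i ω)) :=
        Finset.measurable_sum _ fun j _ =>
          ((((hH m hm).measurable_rejShare j).comp (hBI m hm).measurable_pi).sub
            (((hH m hm).measurable_lowShare j).comp (hBI m hm).measurable_pi))
      -- Each summand is at most 1 in absolute value; the crude bound m₀² serves only integrability.
      refine Integrable.of_bound (hm'.pow_const 2).aestronglyMeasurable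
        (((I₀ m).card : ℝ) ^ 2) (Eventually.of_forall fun ω => ?_)
      rw [Real.norm_eq_abs, abs_pow]
      refine pow_le_pow_left₀ (abs_nonneg _) ((Finset.abs_sum_le_sum_abs _ _).trans ?_) 2
      refine (Finset.sum_le_card_nsmul _ _ 1 fun j _ => ?_).trans (by simp)
      rw [abs_le]
      constructor <;> linarith [(hH m hm).lowShare_nonneg hα hl j fun i => p m i ω,
        (hH m hm).lowShare_le_one hα hl j fun i => p m i ω,
        rejShare_nonneg (α := α) (lam := lam) (e := estimate (g m)) (A := A m) j
          fun i => p m i ω,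
        rejShare_le_one (α := α) (lam := lam) (e := estimate (g m)) (A := A m) j
          fun i => p m i ω]
    · refine squeeze_zero' (g := fun m : ℕ => 1 / (lam * (C₀ / 2)) *
          (∫ ω, (FDP (critBH α m) (I₀ m) (fun i => p m i ω) -
            ∫ ω', FDP (critBH α m) (I₀ m) (fun i => p m i ω') ∂(P m)) ^ 2 ∂(P m) + 1 / (m : ℝ)))
        (Eventually.of_forall fun m => integral_nonneg fun ω => sq_nonneg _) ?_ ?_
      · filter_upwards [h2] with m hm
        exact integral_sq_sum_sub_le hα hαlam hlam.le (half_pos hC₀pos) (by omega) (hg m hm)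
          (hBI m hm)
      · simpa using (hvar.add tendsto_one_div_atTop_nhds_zero_nat).const_mul
          (1 / (lam * (C₀ / 2)))
  refine TendstoInProb.consistent (c := κ₀ * lam * (α / (lam * C₀))) (fun ε hε => ?_) hFDPm
    (Eventually.of_forall fun m ω => FDP_nonneg _ _ _) ?_
  -- On the good event the shares sum to the false discovery proportion and to V(λ)α/(λ m̂₀); a
  -- deviation of ε from the limit then forces one of the two approximations to fail by ε/2.
  · refine tendsto_measure_zero_of_subset_union ?_ hgood
      (tendsto_measure_zero_of_subset_union (Eventually.of_forall fun m => subset_rfl)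
        (hdiff (ε / 2) (half_pos hε)) (hW (ε / 2) (half_pos hε)))
    filter_upwards [h2] with m hm ω hω
    by_contra hcon
    simp only [Set.mem_union, Set.mem_ofPred_eq, not_or, not_not, not_le, sub_zero] at hcon hω
    obtain ⟨hc1, hc2, hc3⟩ := hcon
    have hm0 : (0 : ℝ) < m := by exact_mod_cast (by omega : 0 < m)
    rw [Finset.sum_sub_distrib, sum_rejShare hc1, sum_lowShare hc1] at hc2
    have he := hpos m hm ω
    have heq : (((I₀ m).filter fun j => p m j ω ≤ lam).card : ℝ) / m *
        (α / (lam * (estimate (g m) (fun i => p m i ω) / m))) =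
        (((I₀ m).filter fun j => p m j ω ≤ lam).card : ℝ) *
          (α / (lam * estimate (g m) (fun i => p m i ω))) := by
      field_simp
    rw [heq] at hc3
    have := hω.trans (abs_sub_le _ (((I₀ m).filter fun j => p m j ω ≤ lam).card *
      (α / (lam * estimate (g m) (fun i => p m i ω)))) _)
    linarith
  · filter_upwards [h2] with m hm ω
    exact FDP_le_one (critAdaptive_mono hα.le (hpos m hm ω).le) _ _
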